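/- **Theorem 4.1.** Let $\Delta=\{0,1\}^{\mathbb N}$ be the Cantor set and $C(\Delta)$ the Banach space of real continuous functions on $\Delta$ with the supremum norm. A norm on $X$ is *octahedral* if for every finite-dimensional subspace $E$ and every $\varepsilon>0$ there is $y$ with $\|y\|=1$ and $\|x+y\|\ge(1-\varepsilon)(\|x\|+\|y\|)$ for all $x\in E$. **(a)** $C(\Delta)$ admits an equivalent norm whose bidual norm is octahedral. **(b)** Such norms arise as follows. Let $(N_s)_{s\ge3}$ be any partition of $\mathbb N$ into infinite sets. For $x\in\Delta$ let $\rho_x$ be the product measure on $\Delta$ whose $i$-th factor, $i\in N_s$, is $\frac1s\delta_0+\frac{s-1}s\delta_1$ if $x(i)=1$ and $\frac{s-1}s\delta_0+\frac1s\delta_1$ if $x(i)=0$. Let $T\colon C(\Delta)\to C(\Delta)$, $(Tf)(x)=\int f\,d\rho_x$, and let $\mathcal C=T^*(P_\Delta)\subset C(\Delta)^*$, where $P_\Delta$ is the set of probability measures on $\Delta$. Let $\mathcal Y$ be the linear span of $\mathcal C$, normed by the Minkowski functional $|\cdot|$ of $\mathrm{co}(\mathcal C\cup-\mathcal C)$,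 let $f|_{\mathcal Y}(y)=y(f)$ for $f\in C(\Delta)$ and $y\in\mathcal Y$, and let $(\mathcal Y_*,|\cdot|_*)$ be the closure of $\{f|_{\mathcal Y}: f\in C(\Delta)\}$ in $(\mathcal Y,|\cdot|)^*$. Let $S\colon C(\Delta)\to\mathcal Y_*$, $Sf=f|_{\mathcal Y}$. For $p\in\mathbb N$ let $f_p(x)=1$ if $x(p)=1$ and $f_p(x)=-1$ if $x(p)=0$, and let $Z$ be the closed linear span of $\{f_p\}$ in $C(\Delta)$. Then: 1. $\mathcal C$ is convex and $w^*$-compact, the closed unit ball of $(\mathcal Y,|\cdot|)$ is $\mathrm{co}(\mathcal C\cup-\mathcal C)$, and the evaluation map $y\mapsto(g\mapsto g(y))$ is an isometry of $(\mathcal Y,|\cdot|)$ onto $(\mathcal Y_*,|\cdot|_*)^*$. 2. For every finite $F\subset\mathbb N$ and all real $a_p$ $(p\in F)$, $\big\|\sum_{p\in F}a_pf_p\big\|_\infty=\sum_{p\in F}|a_p|$ and $\frac13\sum_{p\in F}|a_p|\le\big|\sum_{p\in F}a_p\,f_p|_{\mathcal Y}\big|_*\le\sum_{p\in F}|a_p|$.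 3. $\{f_p|_{\mathcal Y}:p\in\mathbb N\}$ is contained in the unit ball of $\mathcal Y_*$ without $0$ and is an octahedral set for the set $B$ of all elements of norm at most $1$ in the norm closure of $S^{**}(C(\Delta)^{**})$ in $(\mathcal Y_*,|\cdot|_*)^{**}$: for all $n$, all $x_1,\dots,x_n\in B$ and every $\varepsilon>0$ there is $p$ with $\|x_i+f_p|_{\mathcal Y}\|\ge(1-\varepsilon)(\|x_i\|+1)$ for $i=1,\dots,n$. 4. For every equivalent norm $q$ on $C(\Delta)$, the formula $f\mapsto|f|_{\mathcal Y}|_*+\inf_{z\in Z}q(f-z)$ defines an equivalent norm on $C(\Delta)$ whose bidual norm is octahedral. -/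

import Mathlib

open MeasureTheory
open scoped Pointwise

set_option maxSynthPendingDepth 3

/-! ### Octahedral norms and octahedral sets -/

/-- A normed space is octahedral if for every finite-dimensional subspace `E` and every `ε > 0`
there is a unit vector `y` with `‖x + y‖ ≥ (1 - ε)(‖x‖ + ‖y‖)` for all `x ∈ E`. -/
def IsOctahedral (X : Type*) [NormedAddCommGroup X] [NormedSpace ℝ X] : Prop :=
  ∀ E : Submodule ℝ X, FiniteDimensional ℝ E → ∀ ε : ℝ, 0 < ε →
    ∃ y : X, ‖y‖ = 1 ∧ ∀ x ∈ E, (1 - ε) * (‖x‖ + ‖y‖) ≤ ‖x + y‖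

/-- The bidual of a normed space, with the bidual norm. -/
abbrev Bidual (X : Type*) [NormedAddCommGroup X] [NormedSpace ℝ X] : Type _ :=
  StrongDual ℝ (StrongDual ℝ X)

/-- `A ⊆ B_X \ {0}` is an octahedral set for `B ⊆ X**` if for all `x₁, …, xₙ ∈ B` and `ε > 0` some
`a ∈ A` satisfies `‖xᵢ + a‖ ≥ (1 - ε)(‖xᵢ‖ + 1)` for every `i`. -/
def IsOctahedralSetFor {X : Type*} [NormedAddCommGroup X] [NormedSpace ℝ X]
    (A : Set X) (B : Set (Bidual X)) : Prop :=
  A ⊆ Metric.closedBall 0 1 \ {0} ∧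
    ∀ (n : ℕ) (x : Fin n → Bidual X), (∀ i, x i ∈ B) → ∀ ε : ℝ, 0 < ε →
      ∃ a ∈ A, ∀ i, (1 - ε) * (‖x i‖ + 1) ≤ ‖x i + NormedSpace.inclusionInDoubleDual ℝ X a‖

/-! ### Equivalent norms -/

/-- The seminorm `q` is an equivalent norm on `X`. -/
def IsEquivNorm {X : Type*} [NormedAddCommGroup X] [NormedSpace ℝ X] (q : Seminorm ℝ X) : Prop :=
  ∃ c C : ℝ, 0 < c ∧ ∀ x, c * ‖x‖ ≤ q x ∧ q x ≤ C * ‖x‖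

/-- The vector space `X`, normed by the equivalent norm `q` instead of by its own norm. -/
def Renormed {X : Type*} [NormedAddCommGroup X] [NormedSpace ℝ X] (q : Seminorm ℝ X)
    (_hq : IsEquivNorm q) : Type _ := X

namespace Renormed

variable {X : Type*} [NormedAddCommGroup X] [NormedSpace ℝ X] (q : Seminorm ℝ X)
  (hq : IsEquivNorm q)

instance : AddCommGroup (Renormed q hq) := inferInstanceAs (AddCommGroup X)

instance : Module ℝ (Renormed q hq) := inferInstanceAs (Module ℝ X)

noncomputable instance : NormedAddCommGroup (Renormed q hq) :=
  AddGroupNorm.toNormedAddCommGroup (E := Renormed q hq)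
    { q.toAddGroupSeminorm with
      eq_zero_of_map_eq_zero' := fun (x : X) hx => by
        obtain ⟨c, C, hc, h⟩ := hq
        have h1 : c * ‖x‖ ≤ 0 := (h x).1.trans_eq hx
        have h2 : ‖x‖ ≤ 0 := by
          by_contra h3
          exact absurd h1 (not_le.2 (mul_pos hc (not_le.1 h3)))
        exact norm_le_zero_iff.1 h2 }

theorem norm_def (x : X) : ‖(show Renormed q hq from x)‖ = q x := rfl

noncomputable instance : NormedSpace ℝ (Renormed q hq) where
  norm_smul_le a x := (map_smul_eq_mul q a x).le

end Renormed

/-! ### Adjoints -/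

/-- The Banach space adjoint `T* : Y* → X*`, `T* φ = φ ∘ T`, of a bounded operator `T : X → Y`. -/
noncomputable def banachAdjoint {X Y : Type*} [NormedAddCommGroup X] [NormedSpace ℝ X]
    [NormedAddCommGroup Y] [NormedSpace ℝ Y] (T : X →L[ℝ] Y) :
    StrongDual ℝ Y →L[ℝ] StrongDual ℝ X :=
  ContinuousLinearMap.precomp ℝ T

/-! ### The Cantor space and Talagrand's operator -/

/-- The Cantor space `Δ = {0,1}^ℕ`; it is identified with the power set of `ℕ` by
`x ↔ {i | x i = true}`. -/
abbrev CantorSpace : Type := ℕ → Bool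

/-- A partition of `ℕ` into infinite sets `N_s`, `s ≥ 3`, given by the function that sends `i` to
the index `s` of the set `N_s = {i | block i = s}` to which it belongs. -/
structure BlockPartition where
  block : ℕ → ℕ
  three_le : ∀ i, 3 ≤ block i
  infinite_block : ∀ s, 3 ≤ s → {i | block i = s}.Infinite

namespace BlockPartition

/-- The measure `(1/s) δ_0 + ((s-1)/s) δ_1` on `{0,1}` if `b = 1`, and
`((s-1)/s) δ_0 + (1/s) δ_1` if `b = 0`. -/
noncomputable def coordMeasure (s : ℕ) (b : Bool) : Measure Bool :=
  ENNReal.ofReal (1 / s) • Measure.dirac (!b) + ENNReal.ofReal ((s - 1) / s) • Measure.dirac b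

theorem isProbabilityMeasure_coordMeasure {s : ℕ} (hs : 3 ≤ s) (b : Bool) :
    IsProbabilityMeasure (coordMeasure s b) := by
  have h3 : (3 : ℝ) ≤ s := by exact_mod_cast hs
  constructor
  simp only [coordMeasure, Measure.coe_add, Measure.coe_smul, Pi.add_apply, Pi.smul_apply,
    measure_univ, smul_eq_mul, mul_one]
  rw [← ENNReal.ofReal_add (by positivity) (div_nonneg (by linarith) (by linarith)),
    ← ENNReal.ofReal_one]
  congr 1
  field_simp
  ring

variable (N : BlockPartition)

instance (i : ℕ) (b : Bool) : IsProbabilityMeasure (coordMeasure (N.block i) b) :=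
  isProbabilityMeasure_coordMeasure (N.three_le i) b

/-- The product measure `ρ_I` on `Δ`, where `I = {i | x i = 1}`: for `i ∈ N_s` the `i`-th factor is
`(1/s) δ_0 + ((s-1)/s) δ_1` if `i ∈ I` and `((s-1)/s) δ_0 + (1/s) δ_1` if `i ∉ I`. -/
noncomputable def rho (x : CantorSpace) : Measure CantorSpace :=
  Measure.infinitePi fun i => coordMeasure (N.block i) (x i)

instance (x : CantorSpace) : IsProbabilityMeasure (N.rho x) := by
  unfold rho; infer_instance

theorem rho_eq_map (x : CantorSpace) :
    N.rho x = (N.rho fun _ => false).map fun ω i => xor (x i) (ω i) := by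
  unfold rho
  rw [Measure.infinitePi_map_pi (f := fun i b => xor (x i) b) _ fun i => .of_discrete]
  congr 1
  funext i
  cases hx : x i
  · simp [coordMeasure]
  · simp [coordMeasure, Measure.map_add, Measure.map_smul,
      Measurable.of_discrete]

theorem integral_rho (x : CantorSpace) (f : C(CantorSpace, ℝ)) :
    ∫ y, f y ∂(N.rho x) = ∫ ω, f (fun i => xor (x i) (ω i)) ∂(N.rho fun _ => false) := by
  rw [rho_eq_map, integral_map]
  · exact (measurable_pi_lambda _ fun i =>
      (Measurable.of_discrete (f := xor (x i))).comp (measurable_pi_apply i)).aemeasurable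
  · exact f.continuous.aestronglyMeasurable

theorem integrable_cont (μ : Measure CantorSpace) [IsProbabilityMeasure μ]
    (f : C(CantorSpace, ℝ)) : Integrable (fun y => f y) μ :=
  Integrable.of_bound f.continuous.aestronglyMeasurable ‖f‖
    (Filter.Eventually.of_forall fun y => f.norm_coe_le_norm y)

theorem continuous_integral_rho (f : C(CantorSpace, ℝ)) :
    Continuous fun x => ∫ y, f y ∂(N.rho x) := by
  simp only [integral_rho]
  have hx : ∀ b : CantorSpace, Continuous fun a : CantorSpace => fun i => xor (a i) (b i) :=
    fun b => continuous_pi fun i =>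
      (continuous_of_discreteTopology (f := fun c => xor c (b i))).comp (continuous_apply i)
  have hy : ∀ a : CantorSpace, Continuous fun b : CantorSpace => fun i => xor (a i) (b i) :=
    fun a => continuous_pi fun i =>
      (continuous_of_discreteTopology (f := fun c => xor (a i) c)).comp (continuous_apply i)
  refine continuous_of_dominated (bound := fun _ => ‖f‖)
    (fun x => (f.continuous.comp (hy x)).aestronglyMeasurable)
    (fun x => Filter.Eventually.of_forall fun ω => f.norm_coe_le_norm _)
    (integrable_const _) (Filter.Eventually.of_forall fun ω => f.continuous.comp (hx ω))

/-- Talagrand's operator `T : C(Δ) → C(Δ)`, `(T f)(I) = ∫ f dρ_I`. -/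
noncomputable def T : C(CantorSpace, ℝ) →L[ℝ] C(CantorSpace, ℝ) :=
  LinearMap.mkContinuous
    { toFun := fun f => ⟨fun x => ∫ y, f y ∂(N.rho x), N.continuous_integral_rho f⟩
      map_add' := fun f g => by
        ext x
        exact integral_add (integrable_cont _ f) (integrable_cont _ g)
      map_smul' := fun a f => by
        ext x
        exact integral_const_mul a _ } 1 (fun f => by
    rw [one_mul, ContinuousMap.norm_le _ (norm_nonneg f)]
    intro x
    simpa using norm_integral_le_of_norm_le_const (μ := N.rho x)
      (Filter.Eventually.of_forall fun y => f.norm_coe_le_norm y))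

theorem T_apply (f : C(CantorSpace, ℝ)) (x : CantorSpace) : N.T f x = ∫ y, f y ∂(N.rho x) := rfl

end BlockPartition

/-- The set `P_Δ` of probability measures on `Δ`, inside `C(Δ)* = M(Δ)`. -/
def probabilityFunctionals : Set (StrongDual ℝ C(CantorSpace, ℝ)) :=
  {φ | ∃ θ : Measure CantorSpace, IsProbabilityMeasure θ ∧ ∀ f, φ f = ∫ x, f x ∂θ}

namespace BlockPartition

variable (N : BlockPartition)

/-- Talagrand's set `𝒞 = T*(P_Δ) ⊆ C(Δ)*`. -/
noncomputable def talagrandSet : Set (StrongDual ℝ C(CantorSpace, ℝ)) :=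
  banachAdjoint N.T '' probabilityFunctionals

/-- The set `𝒦 = co(𝒞 ∪ -𝒞)`. -/
noncomputable def talagrandBall : Set (StrongDual ℝ C(CantorSpace, ℝ)) :=
  convexHull ℝ (N.talagrandSet ∪ -N.talagrandSet)

theorem talagrandSet_nonempty : N.talagrandSet.Nonempty := by
  let x : CantorSpace := fun _ => false
  refine ⟨_, ⟨LinearMap.mkContinuous
    { toFun := fun f : C(CantorSpace, ℝ) => f x
      map_add' := fun f g => rfl
      map_smul' := fun a f => rfl } 1 (fun f => by simpa using f.norm_coe_le_norm x),
    ⟨Measure.dirac x, inferInstance, fun f => ?_⟩, rfl⟩⟩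
  rw [integral_dirac' _ _ f.continuous.stronglyMeasurable]
  rfl

theorem norm_le_of_mem_talagrandSet {φ : StrongDual ℝ C(CantorSpace, ℝ)}
    (hφ : φ ∈ N.talagrandSet) : ‖φ‖ ≤ 1 := by
  obtain ⟨ψ, ⟨θ, hθ, hψ⟩, rfl⟩ := hφ
  refine ContinuousLinearMap.opNorm_le_bound _ zero_le_one fun f => ?_
  change ‖ψ (N.T f)‖ ≤ 1 * ‖f‖
  rw [hψ, one_mul]
  have hT : ‖N.T f‖ ≤ ‖f‖ := by
    have h := (N.T).le_of_opNorm_le (LinearMap.mkContinuous_norm_le _ zero_le_one _) f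
    rwa [one_mul] at h
  calc ‖∫ x, N.T f x ∂θ‖ ≤ ‖N.T f‖ := by
        simpa using norm_integral_le_of_norm_le_const (μ := θ)
          (Filter.Eventually.of_forall fun y => (N.T f).norm_coe_le_norm y)
    _ ≤ ‖f‖ := hT

theorem norm_le_of_mem_talagrandBall {φ : StrongDual ℝ C(CantorSpace, ℝ)}
    (hφ : φ ∈ N.talagrandBall) : ‖φ‖ ≤ 1 := by
  have hsub : N.talagrandBall ⊆ Metric.closedBall 0 1 := by
    refine convexHull_min ?_ (convex_closedBall 0 1)
    rintro ψ (h | h)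
    · simpa using N.norm_le_of_mem_talagrandSet h
    · simpa using N.norm_le_of_mem_talagrandSet (Set.mem_neg.1 h)
  simpa using hsub hφ

theorem balanced_talagrandBall : Balanced ℝ N.talagrandBall := by
  have hneg : ∀ φ ∈ N.talagrandBall, -φ ∈ N.talagrandBall := by
    intro φ hφ
    rw [← Set.mem_neg, talagrandBall, ← convexHull_neg, Set.union_neg, neg_neg, Set.union_comm]
    exact hφ
  have hconv : Convex ℝ N.talagrandBall := convex_convexHull ℝ _
  rintro a ha _ ⟨φ, hφ, rfl⟩
  rw [Real.norm_eq_abs, abs_le] at ha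
  have h := hconv hφ (hneg φ hφ) (a := (1 + a) / 2) (b := (1 - a) / 2)
    (by linarith) (by linarith) (by ring)
  have e : ((1 + a) / 2) • φ + ((1 - a) / 2) • (-φ) = a • φ := by
    rw [smul_neg, ← sub_eq_add_neg, ← sub_smul]
    congr 1
    ring
  rwa [e] at h

/-- The linear span `𝒴` of `𝒞` in `C(Δ)*`. It is not given the norm of `C(Δ)*` but the norm `|·|`
defined below. -/
def TalagrandSpace : Type := ↥(Submodule.span ℝ N.talagrandSet)

namespace TalagrandSpace

instance : AddCommGroup N.TalagrandSpace :=
  inferInstanceAs (AddCommGroup ↥(Submodule.span ℝ N.talagrandSet))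

instance : Module ℝ N.TalagrandSpace :=
  inferInstanceAs (Module ℝ ↥(Submodule.span ℝ N.talagrandSet))

/-- The inclusion of `𝒴` in `C(Δ)*`, as a linear map. -/
def inclₗ : N.TalagrandSpace →ₗ[ℝ] StrongDual ℝ C(CantorSpace, ℝ) :=
  (Submodule.span ℝ N.talagrandSet).subtype

theorem inclₗ_injective : Function.Injective (inclₗ N) :=
  Submodule.subtype_injective _

/-- The set `𝒦 = co(𝒞 ∪ -𝒞)`, as a subset of `𝒴`. -/
def unitSet : Set N.TalagrandSpace := inclₗ N ⁻¹' N.talagrandBall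

theorem balanced_unitSet : Balanced ℝ (unitSet N) := by
  rintro a ha _ ⟨y, hy, rfl⟩
  change inclₗ N (a • y) ∈ N.talagrandBall
  rw [map_smul]
  exact N.balanced_talagrandBall a ha ⟨_, hy, rfl⟩

theorem convex_unitSet : Convex ℝ (unitSet N) :=
  (convex_convexHull ℝ _).linear_preimage (inclₗ N)

theorem absorbent_unitSet : Absorbent ℝ (unitSet N) := by
  have key : ∀ φ ∈ Submodule.span ℝ N.talagrandSet, ∃ r : ℝ, φ ∈ r • N.talagrandBall := by
    intro φ hφ
    induction hφ using Submodule.span_induction with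
    | mem φ h => exact ⟨1, by rw [one_smul]; exact subset_convexHull ℝ _ (Or.inl h)⟩
    | zero =>
      obtain ⟨ψ, hψ⟩ := N.talagrandSet_nonempty
      exact ⟨0, ψ, subset_convexHull ℝ _ (Or.inl hψ), zero_smul ℝ ψ⟩
    | add φ ψ _ _ h₁ h₂ =>
      obtain ⟨r, hr⟩ := h₁
      obtain ⟨t, ht⟩ := h₂
      refine ⟨|r| + |t|, ?_⟩
      have hconv : Convex ℝ N.talagrandBall := convex_convexHull ℝ _
      rw [hconv.add_smul (abs_nonneg r) (abs_nonneg t)]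
      exact Set.add_mem_add (N.balanced_talagrandBall.smul_mono (by simp) hr)
        (N.balanced_talagrandBall.smul_mono (by simp) ht)
    | smul a φ _ h =>
      obtain ⟨r, ψ, hψ, rfl⟩ := h
      exact ⟨a * r, ψ, hψ, mul_smul a r ψ⟩
  rw [absorbent_iff_forall_absorbs_singleton]
  intro y
  obtain ⟨r, ψ, hψ, hr⟩ := key (inclₗ N y) y.2
  have hmem : y ∈ r • unitSet N := by
    by_cases h0 : r = 0
    · subst h0
      have hy : y = 0 := inclₗ_injective N (by rw [map_zero, ← hr]; exact zero_smul ℝ ψ)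
      obtain ⟨χ, hχ⟩ := N.talagrandSet_nonempty
      refine ⟨⟨χ, Submodule.subset_span hχ⟩, subset_convexHull ℝ _ (Or.inl hχ), ?_⟩
      rw [hy]
      exact zero_smul ℝ _
    · refine ⟨r⁻¹ • y, ?_, smul_inv_smul₀ h0 y⟩
      change inclₗ N (r⁻¹ • y) ∈ N.talagrandBall
      rw [map_smul, ← hr]
      change r⁻¹ • r • ψ ∈ _
      rwa [inv_smul_smul₀ h0]
  rw [absorbs_iff_norm]
  exact ⟨‖r‖, fun c hc => Set.singleton_subset_iff.2 ((balanced_unitSet N).smul_mono hc hmem)⟩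

/-- The norm `|·|` of `𝒴`, as a seminorm: the Minkowski functional of `𝒦`. -/
noncomputable def gaugeNorm : Seminorm ℝ N.TalagrandSpace :=
  gaugeSeminorm (balanced_unitSet N) (convex_unitSet N) (absorbent_unitSet N)

theorem norm_inclₗ_le_gaugeNorm (y : N.TalagrandSpace) : ‖inclₗ N y‖ ≤ gaugeNorm N y := by
  refine le_of_forall_gt_imp_ge_of_dense fun a ha => ?_
  obtain ⟨b, hb0, hba, z, hz, hzy⟩ := exists_lt_of_gauge_lt (absorbent_unitSet N) ha
  have hz1 : ‖inclₗ N z‖ ≤ 1 := N.norm_le_of_mem_talagrandBall hz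
  have e : inclₗ N y = b • inclₗ N z := by rw [← map_smul]; exact congrArg _ hzy.symm
  rw [e, norm_smul, Real.norm_of_nonneg hb0.le]
  nlinarith

/-- `𝒴` is normed by the Minkowski functional `|·|` of `𝒦 = co(𝒞 ∪ -𝒞)`. -/
noncomputable instance : NormedAddCommGroup N.TalagrandSpace :=
  AddGroupNorm.toNormedAddCommGroup
    { (gaugeNorm N).toAddGroupSeminorm with
      eq_zero_of_map_eq_zero' := fun y hy => inclₗ_injective N (by
        have h := norm_inclₗ_le_gaugeNorm N y
        have hy' : gaugeNorm N y = 0 := hy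
        rw [hy'] at h
        rw [map_zero]
        exact norm_le_zero_iff.1 h) }

theorem norm_def (y : N.TalagrandSpace) : ‖y‖ = gauge (unitSet N) y := rfl

noncomputable instance : NormedSpace ℝ N.TalagrandSpace where
  norm_smul_le a y := (map_smul_eq_mul (gaugeNorm N) a y).le

/-- The bounded inclusion `i : (𝒴, |·|) → C(Δ)*`. -/
noncomputable def incl : N.TalagrandSpace →L[ℝ] StrongDual ℝ C(CantorSpace, ℝ) :=
  (inclₗ N).mkContinuous 1 fun y => by
    rw [one_mul]
    exact norm_inclₗ_le_gaugeNorm N y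

end TalagrandSpace

/-- The restriction map `f ↦ f|_𝒴` from `C(Δ)` to `(𝒴, |·|)*`, where `f|_𝒴(y) = y(f)`. -/
noncomputable def restrict : C(CantorSpace, ℝ) →L[ℝ] StrongDual ℝ N.TalagrandSpace :=
  (TalagrandSpace.incl N).flip

theorem restrict_apply (f : C(CantorSpace, ℝ)) (y : N.TalagrandSpace) :
    N.restrict f y = TalagrandSpace.incl N y f := rfl

/-- The predual `(𝒴_*, |·|_*)` of `(𝒴, |·|)`: the closure in `(𝒴, |·|)*` of `{f|_𝒴 : f ∈ C(Δ)}`, with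
the norm of `(𝒴, |·|)*`. -/
noncomputable def predual : Submodule ℝ (StrongDual ℝ N.TalagrandSpace) :=
  N.restrict.range.topologicalClosure

/-- The operator `S : C(Δ) → 𝒴_*`, `S f = f|_𝒴`. -/
noncomputable def S : C(CantorSpace, ℝ) →L[ℝ] N.predual :=
  N.restrict.codRestrict N.predual fun f =>
    Submodule.le_topologicalClosure _ (LinearMap.mem_range_self _ f)

/-- The canonical map `𝒴 → (𝒴_*)*`, `y ↦ (g ↦ g(y))`. -/
noncomputable def toDualPredual : N.TalagrandSpace →L[ℝ] StrongDual ℝ N.predual :=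
  N.predual.subtypeL.flip

theorem toDualPredual_apply (y : N.TalagrandSpace) (g : N.predual) :
    N.toDualPredual y g = (g : StrongDual ℝ N.TalagrandSpace) y := rfl

/-- The second adjoint `S** : C(Δ)** → (𝒴_*)**`. It sends `x** ∈ C(Δ)**` to the restriction of
`x**` to `𝒴 = (𝒴_*)*`. -/
noncomputable def bidualS : Bidual C(CantorSpace, ℝ) →L[ℝ] Bidual N.predual :=
  banachAdjoint (banachAdjoint N.S)

/-- The part of the closed unit ball of `(𝒴_*)**` that lies in the norm closure of
`S**(C(Δ)**) = {x**|_𝒴 : x** ∈ C(Δ)**}`. -/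
noncomputable def restrictedBidualBall : Set (Bidual N.predual) :=
  closure (Set.range N.bidualS) ∩ Metric.closedBall 0 1

end BlockPartition

/-- The coordinate function `f_p` on `Δ`: `f_p(x) = -1` if `x(p) = 0` and `f_p(x) = 1` if
`x(p) = 1`. -/
noncomputable def coordFun (p : ℕ) : C(CantorSpace, ℝ) where
  toFun x := if x p then 1 else -1
  continuous_toFun := (continuous_of_discreteTopology (f := fun b : Bool =>
    if b then (1 : ℝ) else -1)).comp (continuous_apply p)

/-- The closed linear span `Z` of the coordinate functions in `C(Δ)`. -/
noncomputable def coordSpan : Submodule ℝ C(CantorSpace, ℝ) :=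
  (Submodule.span ℝ (Set.range coordFun)).topologicalClosure

/-! ### Separation in the weak-star topology -/

/-! Everything rests on the identity `‖S f‖ = ‖T f‖`. The set `co(𝒞 ∪ -𝒞)` is w*-compact, hence by
the bipolar theorem it consists of the functionals `φ` with `φ f ≤ ‖T f‖` for all `f`
(`mem_talagrandBall_of_le`). This identifies the unit ball of `𝒴`, the norm of `𝒴_*` and the dual of
`𝒴_*`. Since `T f_p = (1 - 2/s) f_p` for `p ∈ N_s` and `s ≥ 3`, the operator `S` shrinks norms on
`Z` by a factor of at least `1/3`.

For octahedrality let `X ∈ C(Δ)**`. The norm of `S** X` is the supremum of `|X|` over `𝒞`, so it is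
nearly attained at some `T* θ`, with sign `σ`. Let `θ_p` be the image of `θ` under setting
coordinate `p` to the value that has sign `σ`. Then `(T* θ_p)(f_p) = (1 - 2/s) σ`, which is close to
`σ` when `s` is large. Moreover `X(T* θ_p)` is close to `X(T* θ)` for all but finitely many `p ∈
N_s`. Indeed changing coordinate `p` of `x` multiplies `ρ_x` by a density `h_p` depending on the
`p`-th coordinate only. The functions `h_p - 1` are bounded by `s` and orthogonal in `L²(ρ_x)`, so a
signed sum of `n` of the differences `T* θ_p - T* θ` has norm at most `s√n`, whereas `n` values of
`X` of size `δ` would force it to be of order `n` (`finite_setOf_le_abs_update_sub`). Thus `T* θ_p`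
almost norms `S** X` and `f_p` with the same sign, and one `p` serves finitely many `X`.

Finally, the norm `‖S f‖ + dist_q(f, Z)` is an `ℓ₁`-sum, and so is its bidual norm
(`norm_eq_add_of_norm_eq_add`). Adding `f_p ∈ Z` does not affect the second summand, so
octahedrality is inherited from the first. The norm is equivalent because `S` is bounded below on
`Z`. -/

theorem WeakBilin.exists_separating_vector {E F : Type*} [AddCommGroup E] [Module ℝ E]
    [AddCommGroup F] [Module ℝ F] (B : E →ₗ[ℝ] F →ₗ[ℝ] ℝ) {K : Set (WeakBilin B)}
    (hconv : Convex ℝ K) (hK : IsClosed K) {φ : WeakBilin B} (hφ : φ ∉ K) :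
    ∃ (x : F) (u : ℝ), (∀ ψ ∈ K, B ψ x < u) ∧ u < B φ x := by
  obtain ⟨G, u, hu, hG⟩ := geometric_hahn_banach_closed_point hconv hK hφ
  -- Every functional continuous for the weak topology is the pairing with a vector of `F`.
  obtain ⟨x, rfl⟩ := LinearMap.dualEmbedding_surjective B G
  exact ⟨x, u, hu, hG⟩

theorem WeakDual.exists_separating_vector {X : Type*} [NormedAddCommGroup X] [NormedSpace ℝ X]
    {K : Set (WeakDual ℝ X)} (hconv : Convex ℝ K) (hK : IsClosed K) {φ : WeakDual ℝ X}
    (hφ : φ ∉ K) : ∃ (x : X) (u : ℝ), (∀ ψ ∈ K, ψ x < u) ∧ u < φ x :=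
  WeakBilin.exists_separating_vector (topDualPairing ℝ X) hconv hK hφ

/-! ### Probability measures as functionals -/

/-- Integration against a probability measure on the Cantor space, as a functional. -/
noncomputable def integralFunctional (θ : ProbabilityMeasure CantorSpace) :
    StrongDual ℝ C(CantorSpace, ℝ) :=
  LinearMap.mkContinuous
    { toFun := fun f => ∫ x, f x ∂(θ : Measure CantorSpace)
      map_add' := fun f g => integral_add (BlockPartition.integrable_cont _ f)
        (BlockPartition.integrable_cont _ g)
      map_smul' := fun a f => integral_const_mul a _ } 1 (fun f => by
    rw [one_mul]
    simpa using norm_integral_le_of_norm_le_const (μ := (θ : Measure CantorSpace))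
      (Filter.Eventually.of_forall fun y => f.norm_coe_le_norm y))

theorem integralFunctional_apply (θ : ProbabilityMeasure CantorSpace) (f : C(CantorSpace, ℝ)) :
    integralFunctional θ f = ∫ x, f x ∂(θ : Measure CantorSpace) := rfl

theorem range_integralFunctional : Set.range integralFunctional = probabilityFunctionals := by
  ext φ
  constructor
  · rintro ⟨θ, rfl⟩
    exact ⟨θ, inferInstance, fun f => rfl⟩
  · rintro ⟨θ, hθ, h⟩
    exact ⟨⟨θ, hθ⟩, ContinuousLinearMap.ext fun f => (h f).symm⟩

theorem norm_apply_le_of_mem_probabilityFunctionals {ψ : StrongDual ℝ C(CantorSpace, ℝ)}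
    (hψ : ψ ∈ probabilityFunctionals) (f : C(CantorSpace, ℝ)) : |ψ f| ≤ ‖f‖ := by
  obtain ⟨θ, hθ, h⟩ := hψ
  rw [h, ← Real.norm_eq_abs]
  simpa using norm_integral_le_of_norm_le_const (μ := θ)
    (Filter.Eventually.of_forall fun y => f.norm_coe_le_norm y)

theorem convex_probabilityFunctionals : Convex ℝ probabilityFunctionals := by
  rintro φ ⟨θ, hθ, hφ⟩ ψ ⟨η, hη, hψ⟩ a b ha hb hab
  refine ⟨ENNReal.ofReal a • θ + ENNReal.ofReal b • η, ⟨?_⟩, fun f => ?_⟩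
  · simp [← ENNReal.ofReal_add ha hb, hab]
  · rw [integral_add_measure ((BlockPartition.integrable_cont θ f).smul_measure (by simp))
      ((BlockPartition.integrable_cont η f).smul_measure (by simp)),
      integral_smul_measure, integral_smul_measure, ENNReal.toReal_ofReal ha,
      ENNReal.toReal_ofReal hb, ← hφ, ← hψ]
    rfl

theorem integralFunctional_dirac (x : CantorSpace) (f : C(CantorSpace, ℝ)) :
    integralFunctional ⟨Measure.dirac x, inferInstance⟩ f = f x :=
  integral_dirac' _ _ f.continuous.stronglyMeasurable

/-! ### /Compactness of Talagrand's set and the bipolar description of its ball -/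

namespace BlockPartition

variable (N : BlockPartition)

theorem convex_talagrandSet : Convex ℝ N.talagrandSet :=
  convex_probabilityFunctionals.linear_image (banachAdjoint N.T).toLinearMap

/-- The probability measures on the compact space `Δ` form a compact space, and `θ ↦ T* θ` is
continuous from it to the w*-topology. -/
theorem isCompact_talagrandSet :
    IsCompact (WeakDual.toStrongDual ⁻¹' N.talagrandSet :
      Set (WeakDual ℝ C(CantorSpace, ℝ))) := by
  let g : ProbabilityMeasure CantorSpace → WeakDual ℝ C(CantorSpace, ℝ) := fun θ =>
    StrongDual.toWeakDual (banachAdjoint N.T (integralFunctional θ))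
  have hg : Continuous g := by
    refine WeakDual.continuous_of_continuous_eval fun f => ?_
    exact ProbabilityMeasure.continuous_integral_boundedContinuousFunction
      (BoundedContinuousFunction.mkOfCompact (N.T f))
  have h : (WeakDual.toStrongDual ⁻¹' N.talagrandSet : Set (WeakDual ℝ C(CantorSpace, ℝ)))
      = Set.range g := by
    ext φ
    constructor
    · rintro ⟨ψ, hψ, h⟩
      rw [← range_integralFunctional] at hψ
      obtain ⟨θ, rfl⟩ := hψ
      exact ⟨θ, h⟩
    · rintro ⟨θ, rfl⟩
      exact ⟨integralFunctional θ, range_integralFunctional ▸ Set.mem_range_self θ, rfl⟩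
  rw [h]
  exact isCompact_range hg

theorem dirac_mem_talagrandSet (x : CantorSpace) :
    banachAdjoint N.T (integralFunctional ⟨Measure.dirac x, inferInstance⟩) ∈ N.talagrandSet :=
  ⟨_, range_integralFunctional ▸ Set.mem_range_self _, rfl⟩

theorem dirac_comp_T_apply (x : CantorSpace) (f : C(CantorSpace, ℝ)) :
    banachAdjoint N.T (integralFunctional ⟨Measure.dirac x, inferInstance⟩) f = N.T f x :=
  integralFunctional_dirac x (N.T f)

theorem abs_apply_le_of_mem_talagrandBall {φ : StrongDual ℝ C(CantorSpace, ℝ)}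
    (hφ : φ ∈ N.talagrandBall) (f : C(CantorSpace, ℝ)) : |φ f| ≤ ‖N.T f‖ := by
  have hC : ∀ ψ ∈ N.talagrandSet, |ψ f| ≤ ‖N.T f‖ := by
    rintro _ ⟨ψ, hψ, rfl⟩
    exact norm_apply_le_of_mem_probabilityFunctionals hψ (N.T f)
  have hconv : Convex ℝ {ψ : StrongDual ℝ C(CantorSpace, ℝ) | |ψ f| ≤ ‖N.T f‖} := by
    intro ψ hψ χ hχ a b ha hb hab
    have h := (convex_closedBall (0 : ℝ) ‖N.T f‖) (x := ψ f) (by simpa using hψ) (y := χ f)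
      (by simpa using hχ) ha hb hab
    simpa using h
  refine convexHull_min ?_ hconv hφ
  rintro ψ (h | h)
  · exact hC ψ h
  · simpa using hC _ (Set.mem_neg.1 h)

/-- As `𝒞` and `-𝒞` are convex, the hull of their union consists of the segments joining them. It is
therefore a continuous image of `[0,1] × 𝒞 × (-𝒞)`, and no closure has to be taken. -/
theorem isCompact_talagrandBall :
    IsCompact (WeakDual.toStrongDual ⁻¹' N.talagrandBall :
      Set (WeakDual ℝ C(CantorSpace, ℝ))) := by
  let K : Set (WeakDual ℝ C(CantorSpace, ℝ)) := WeakDual.toStrongDual ⁻¹' N.talagrandSet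
  have hK : IsCompact K := N.isCompact_talagrandSet
  have him : IsCompact ((fun t : ℝ × WeakDual ℝ C(CantorSpace, ℝ) × WeakDual ℝ C(CantorSpace, ℝ) =>
      (1 - t.1) • t.2.1 + t.1 • t.2.2) '' (Set.Icc 0 1 ×ˢ K ×ˢ (-K))) :=
    (isCompact_Icc.prod (hK.prod hK.neg)).image (by fun_prop)
  convert him using 1
  have hne := N.talagrandSet_nonempty
  rw [talagrandBall, convexHull_union hne hne.neg, N.convex_talagrandSet.convexHull_eq,
    N.convex_talagrandSet.neg.convexHull_eq]
  ext φ
  simp only [Set.mem_preimage, mem_convexJoin, segment_eq_image, Set.mem_image, Set.mem_prod,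
    Prod.exists]
  constructor
  · rintro ⟨a, ha, b, hb, t, ht, h⟩
    exact ⟨t, a, b, ⟨ht, ha, hb⟩, h⟩
  · rintro ⟨t, a, b, ⟨ht, ha, hb⟩, h⟩
    exact ⟨a, ha, b, hb, t, ht, h⟩

/-- The bipolar theorem for Talagrand's ball. -/
theorem mem_talagrandBall_of_le {φ : StrongDual ℝ C(CantorSpace, ℝ)}
    (hφ : ∀ f, φ f ≤ ‖N.T f‖) : φ ∈ N.talagrandBall := by
  by_contra hn
  have hconv : Convex ℝ (WeakDual.toStrongDual ⁻¹' N.talagrandBall :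
      Set (WeakDual ℝ C(CantorSpace, ℝ))) :=
    (convex_convexHull ℝ _).linear_preimage WeakDual.toStrongDual.toLinearMap
  obtain ⟨f, u, hu, hF⟩ := WeakDual.exists_separating_vector (φ := StrongDual.toWeakDual φ) hconv
    N.isCompact_talagrandBall.isClosed hn
  -- The separating bound is tested on `T* δ_x` and `-T* δ_x`; together they give `‖T f‖ ≤ u < φ f`.
  have h1 : ∀ x, |N.T f x| ≤ u := fun x => by
    have hx := N.dirac_mem_talagrandSet x
    have hp := subset_convexHull ℝ (N.talagrandSet ∪ -N.talagrandSet) (Or.inl hx)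
    have hm := subset_convexHull ℝ (N.talagrandSet ∪ -N.talagrandSet)
      (Or.inr (Set.neg_mem_neg.2 hx))
    have h2 := hu _ hp
    have h3 := hu _ hm
    have e := N.dirac_comp_T_apply x f
    refine abs_le.2 ⟨?_, ?_⟩
    · have : -N.T f x < u := by rw [← e]; exact h3
      linarith
    · rw [← e]; exact h2.le
  have h0 : 0 ≤ u := (abs_nonneg _).trans (h1 fun _ => false)
  have h2 : ‖N.T f‖ ≤ u := (ContinuousMap.norm_le _ h0).2 h1
  have h3 : u < φ f := hF
  linarith [hφ f]

/-! ### The unit ball of `𝒴` -/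

namespace TalagrandSpace

theorem abs_incl_apply_le (y : N.TalagrandSpace) (f : C(CantorSpace, ℝ)) :
    |incl N y f| ≤ ‖y‖ * ‖N.T f‖ := by
  have key : ∀ a, ‖y‖ < a → |incl N y f| ≤ a * ‖N.T f‖ := fun a ha => by
    obtain ⟨b, hb0, hba, z, hz, hzy⟩ := exists_lt_of_gauge_lt (absorbent_unitSet N) ha
    have hz1 := N.abs_apply_le_of_mem_talagrandBall hz f
    have e : incl N y f = b * inclₗ N z f := by
      rw [← hzy]
      exact DFunLike.congr_fun (map_smul (inclₗ N) b z) f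
    rw [e, abs_mul, abs_of_pos hb0]
    have ha0 : 0 ≤ a := hb0.le.trans hba.le
    gcongr
  -- The gauge is an infimum that need not be attained, so the bound is taken at `‖y‖ + 1/(n+1)` and
  -- passed to the limit.
  refine le_of_tendsto_of_tendsto' (tendsto_const_nhds (f := Filter.atTop (α := ℕ)))
    (((tendsto_const_nhds (x := ‖y‖)).add tendsto_one_div_add_atTop_nhds_zero_nat).mul_const
      ‖N.T f‖ |>.trans (by rw [add_zero])) fun n => key _ ?_
  have : (0 : ℝ) < 1 / (n + 1) := Nat.one_div_pos_of_nat
  linarith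

/-- A set is in general smaller than the closed unit ball of its gauge; here the bipolar theorem
closes the gap. -/
theorem norm_le_one_iff (y : N.TalagrandSpace) : ‖y‖ ≤ 1 ↔ incl N y ∈ N.talagrandBall := by
  refine ⟨fun h => N.mem_talagrandBall_of_le fun f => ?_, fun h => gauge_le_one_of_mem h⟩
  refine (le_abs_self _).trans ((abs_incl_apply_le N y f).trans ?_)
  exact mul_le_of_le_one_left (norm_nonneg _) h

theorem exists_incl_eq {φ : StrongDual ℝ C(CantorSpace, ℝ)} (hφ : φ ∈ N.talagrandBall) :
    ∃ y : N.TalagrandSpace, ‖y‖ ≤ 1 ∧ incl N y = φ := by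
  have h : φ ∈ Submodule.span ℝ N.talagrandSet := by
    refine convexHull_min ?_ (Submodule.convex _) hφ
    rintro ψ (h | h)
    · exact Submodule.subset_span h
    · simpa using Submodule.neg_mem _ (Submodule.subset_span (R := ℝ) (Set.mem_neg.1 h))
  exact ⟨⟨φ, h⟩, (norm_le_one_iff N _).2 hφ, rfl⟩

theorem incl_image_closedBall : incl N '' Metric.closedBall 0 1 = N.talagrandBall := by
  ext φ
  constructor
  · rintro ⟨y, hy, rfl⟩
    exact (norm_le_one_iff N y).1 (by simpa using hy)
  · intro h
    obtain ⟨y, hy, rfl⟩ := exists_incl_eq N h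
    exact ⟨y, by simpa using hy, rfl⟩

end TalagrandSpace

/-! ### The predual `𝒴_*` and its dual -/

open TalagrandSpace

/-- Elements of the unit ball of `𝒴` are dominated by `‖T f‖`, and the functionals `T* δ_x` recover
each value `T f x`. -/
theorem norm_S (f : C(CantorSpace, ℝ)) : ‖N.S f‖ = ‖N.T f‖ := by
  change ‖N.restrict f‖ = _
  apply le_antisymm
  · refine ContinuousLinearMap.opNorm_le_bound _ (norm_nonneg _) fun y => ?_
    rw [mul_comm]
    exact abs_incl_apply_le N y f
  · refine (ContinuousMap.norm_le _ (norm_nonneg _)).2 fun x => ?_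
    obtain ⟨y, hy, e⟩ := exists_incl_eq N (subset_convexHull ℝ _
      (Or.inl (N.dirac_mem_talagrandSet x)))
    rw [← N.dirac_comp_T_apply x f, ← e]
    exact ((N.restrict f).le_opNorm y).trans (mul_le_of_le_one_right (norm_nonneg _) hy)

theorem denseRange_S : DenseRange N.S := by
  intro g
  rw [Metric.mem_closure_iff]
  intro ε hε
  have hg : (g : StrongDual ℝ N.TalagrandSpace) ∈ closure (N.restrict.range : Set _) := g.2
  obtain ⟨_, ⟨f, rfl⟩, hf⟩ := Metric.mem_closure_iff.1 hg ε hε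
  exact ⟨N.S f, ⟨f, rfl⟩, hf⟩

theorem norm_toDualPredual_le (y : N.TalagrandSpace) : ‖N.toDualPredual y‖ ≤ ‖y‖ := by
  refine ContinuousLinearMap.opNorm_le_bound _ (norm_nonneg _) fun g => ?_
  rw [mul_comm]
  exact (g : StrongDual ℝ N.TalagrandSpace).le_opNorm y

/-- By `norm_S`, the functional `ξ ∘ S` is dominated by `‖T f‖`, so it lies in Talagrand's ball. The
range of `S` is dense, so it determines `ξ`. -/
theorem exists_toDualPredual_eq (ξ : StrongDual ℝ N.predual) (hξ : ‖ξ‖ ≤ 1) :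
    ∃ y, ‖y‖ ≤ 1 ∧ N.toDualPredual y = ξ := by
  have h : ξ.comp N.S ∈ N.talagrandBall := N.mem_talagrandBall_of_le fun f => by
    rw [← N.norm_S f]
    exact (le_abs_self _).trans ((ξ.le_opNorm _).trans
      (mul_le_of_le_one_left (norm_nonneg _) hξ))
  obtain ⟨y, hy, e⟩ := exists_incl_eq N h
  refine ⟨y, hy, ?_⟩
  have := N.denseRange_S.equalizer (N.toDualPredual y).continuous ξ.continuous
    (funext fun f => DFunLike.congr_fun e f)
  exact DFunLike.coe_injective this

theorem toDualPredual_injective : Function.Injective N.toDualPredual := by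
  rw [injective_iff_map_eq_zero]
  intro y hy
  apply inclₗ_injective N
  rw [map_zero]
  ext f
  exact DFunLike.congr_fun hy (N.S f)

theorem norm_toDualPredual (y : N.TalagrandSpace) : ‖N.toDualPredual y‖ = ‖y‖ := by
  refine le_antisymm (N.norm_toDualPredual_le y) ?_
  rcases eq_or_ne y 0 with rfl | hy
  · simp
  have h0 : N.toDualPredual y ≠ 0 := fun h => hy (N.toDualPredual_injective (by rw [h, map_zero]))
  have hr : 0 < ‖N.toDualPredual y‖ := norm_pos_iff.2 h0
  -- The normalised image of `y` comes from some `z` with `‖z‖ ≤ 1`; injectivity forces `z` to be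
  -- the corresponding multiple of `y`, which gives the lower bound.
  obtain ⟨z, hz, e⟩ := N.exists_toDualPredual_eq (‖N.toDualPredual y‖⁻¹ • N.toDualPredual y)
    (by rw [norm_smul, norm_inv, norm_norm, inv_mul_cancel₀ hr.ne'])
  rw [← map_smul] at e
  have := N.toDualPredual_injective e
  rw [this, norm_smul, norm_inv, norm_norm, inv_mul_le_iff₀ hr, mul_one] at hz
  exact hz

theorem toDualPredual_surjective : Function.Surjective N.toDualPredual := by
  intro ξ
  rcases eq_or_ne ξ 0 with rfl | hξ
  · exact ⟨0, map_zero _⟩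
  have hr : 0 < ‖ξ‖ := norm_pos_iff.2 hξ
  obtain ⟨z, hz, e⟩ := N.exists_toDualPredual_eq (‖ξ‖⁻¹ • ξ)
    (by rw [norm_smul, norm_inv, norm_norm, inv_mul_cancel₀ hr.ne'])
  exact ⟨‖ξ‖ • z, by rw [map_smul, e, smul_inv_smul₀ hr.ne']⟩

end BlockPartition

/-! ### Changing one coordinate of a product measure -/

/-- Replacing one factor of an infinite product of measures on `{0,1}` by a measure with density
`g` amounts to multiplying the product by the density `g` in that coordinate. -/
theorem infinitePi_eq_add_restrict {μ ν : ℕ → Measure Bool} [∀ i, IsProbabilityMeasure (μ i)]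
    [∀ i, IsProbabilityMeasure (ν i)] {p : ℕ} (hν : ∀ i, i ≠ p → ν i = μ i) {g : Bool → ENNReal}
    (hg : ν p = g true • (μ p).restrict {true} + g false • (μ p).restrict {false}) :
    Measure.infinitePi ν = g true • (Measure.infinitePi μ).restrict {y | y p = true} +
      g false • (Measure.infinitePi μ).restrict {y | y p = false} := by
  symm
  apply Measure.eq_infinitePi
  intro s t ht
  -- The coordinate `p` may be absent from `s`. With the full factor there, every box can be written
  -- over `insert p (s.erase p)`, and cutting by `y p = c` only replaces `u` by `u ∩ {c}`.
  set u : Set Bool := if p ∈ s then t p else Set.univ with hu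
  have hpi : Set.pi (s : Set ℕ) t = Set.pi ((insert p (s.erase p) : Finset ℕ) : Set ℕ)
      (Function.update t p u) := by
    ext y
    simp only [Set.mem_pi, Finset.mem_coe, Finset.mem_insert, Finset.mem_erase]
    constructor
    · intro h i hi
      rcases eq_or_ne i p with rfl | hip
      · by_cases his : i ∈ s
        · simpa [hu, his] using h i his
        · simp [hu, his]
      · simpa [hip] using h i (by tauto)
    · intro h i hi
      have := h i (by tauto)
      rcases eq_or_ne i p with rfl | hip
      · simpa [hu, hi] using this
      · simpa [hip] using this
  have hprod : ∏ i ∈ s, ν i (t i) = ν p u * ∏ i ∈ s.erase p, μ i (t i) := by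
    have h1 : ∏ i ∈ s.erase p, μ i (t i) = ∏ i ∈ s.erase p, ν i (t i) :=
      Finset.prod_congr rfl fun i hi => by rw [hν i (Finset.ne_of_mem_erase hi)]
    by_cases hp : p ∈ s
    · rw [h1, hu, if_pos hp, Finset.mul_prod_erase s (fun i => ν i (t i)) hp]
    · rw [h1, hu, if_neg hp, measure_univ, one_mul, Finset.erase_eq_of_notMem hp]
  have hrestrict : ∀ c : Bool, (Measure.infinitePi μ).restrict {y | y p = c} (Set.pi s t) =
      μ p (u ∩ {c}) * ∏ i ∈ s.erase p, μ i (t i) := by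
    intro c
    have hmeas : MeasurableSet {y : ℕ → Bool | y p = c} :=
      measurableSet_eq_fun (measurable_pi_apply p) measurable_const
    have e : Set.pi (s : Set ℕ) t ∩ {y | y p = c} =
        Set.pi ((insert p (s.erase p) : Finset ℕ) : Set ℕ) (Function.update t p (u ∩ {c})) := by
      rw [hpi]
      ext y
      simp only [Set.mem_inter_iff, Set.mem_pi, Finset.mem_coe, Finset.mem_insert, Set.mem_ofPred_eq]
      constructor
      · rintro ⟨h, hc⟩ i hi
        have := h i hi
        rcases eq_or_ne i p with rfl | hip
        · simpa [hc] using this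
        · simpa [hip] using this
      · intro h
        have hp := h p (Or.inl rfl)
        rw [Function.update_self] at hp
        refine ⟨fun i hi => ?_, hp.2⟩
        rcases eq_or_ne i p with rfl | hip
        · simpa using hp.1
        · simpa [hip] using h i hi
    rw [Measure.restrict_apply' hmeas, e, Measure.infinitePi_pi _ (fun i _ => .of_discrete),
      Finset.prod_insert (Finset.notMem_erase p s), Function.update_self]
    congr 1
    exact Finset.prod_congr rfl fun i hi => by
      rw [Function.update_of_ne (Finset.ne_of_mem_erase hi)]
  rw [Measure.add_apply, Measure.smul_apply, Measure.smul_apply, hrestrict, hrestrict, hprod, hg,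
    Measure.add_apply, Measure.smul_apply, Measure.smul_apply,
    Measure.restrict_apply .of_discrete, Measure.restrict_apply .of_discrete]
  simp only [smul_eq_mul]
  ring

/-! ### Densities of coordinate changes and their orthogonality -/

namespace BlockPartition

/-- The mass that `coordMeasure s b` gives to the point `c`. -/
noncomputable def coordMass (s : ℕ) (b c : Bool) : ℝ := if c = b then (s - 1) / s else 1 / s

theorem coordMass_pos {s : ℕ} (hs : 3 ≤ s) (b c : Bool) : 0 < coordMass s b c := by
  have h3 : (3 : ℝ) ≤ s := by exact_mod_cast hs
  unfold coordMass
  split_ifs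
  · exact div_pos (by linarith) (by linarith)
  · positivity

theorem coordMeasure_eq (s : ℕ) (b : Bool) :
    coordMeasure s b = ENNReal.ofReal (coordMass s b true) • Measure.dirac true +
      ENNReal.ofReal (coordMass s b false) • Measure.dirac false := by
  cases b <;> simp [coordMeasure, coordMass, add_comm]

theorem coordMeasure_eq_density {s : ℕ} (hs : 3 ≤ s) (a b : Bool) :
    coordMeasure s b =
      ENNReal.ofReal (coordMass s b true / coordMass s a true) • (coordMeasure s a).restrict {true} +
      ENNReal.ofReal (coordMass s b false / coordMass s a false) •
        (coordMeasure s a).restrict {false} := by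
  have key : ∀ c, ENNReal.ofReal (coordMass s b c / coordMass s a c) *
      ENNReal.ofReal (coordMass s a c) = ENNReal.ofReal (coordMass s b c) := fun c => by
    rw [← ENNReal.ofReal_mul (div_nonneg (coordMass_pos hs _ _).le (coordMass_pos hs _ _).le),
      div_mul_cancel₀ _ (coordMass_pos hs _ _).ne']
  rw [coordMeasure_eq s a, coordMeasure_eq s b]
  simp only [Measure.restrict_add, Measure.restrict_smul, restrict_dirac,
    Set.mem_singleton_iff]
  simp [smul_smul, key]

variable (N : BlockPartition)

/-- The density of `ρ_{x'}` with respect to `ρ_x`, where `x'` is obtained from `x` by setting the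
coordinate `p` to `b`. -/
noncomputable def density (x : CantorSpace) (p : ℕ) (b : Bool) : C(CantorSpace, ℝ) where
  toFun y := coordMass (N.block p) b (y p) / coordMass (N.block p) (x p) (y p)
  continuous_toFun := (continuous_of_discreteTopology (f := fun c : Bool =>
    coordMass (N.block p) b c / coordMass (N.block p) (x p) c)).comp (continuous_apply p)

theorem rho_update (x : CantorSpace) (p : ℕ) (b : Bool) :
    N.rho (Function.update x p b) =
      ENNReal.ofReal (coordMass (N.block p) b true / coordMass (N.block p) (x p) true) •
        (N.rho x).restrict {y | y p = true} +
      ENNReal.ofReal (coordMass (N.block p) b false / coordMass (N.block p) (x p) false) •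
        (N.rho x).restrict {y | y p = false} := by
  refine infinitePi_eq_add_restrict
    (g := fun c => ENNReal.ofReal (coordMass (N.block p) b c / coordMass (N.block p) (x p) c))
    (fun i hi => ?_) ?_
  · rw [Function.update_of_ne hi]
  · rw [Function.update_self]
    exact coordMeasure_eq_density (N.three_le p) _ _

/-- The density is constant on each half `{y | y p = c}`, where it equals the weight given to that
half in `rho_update`. -/
theorem T_update (f : C(CantorSpace, ℝ)) (x : CantorSpace) (p : ℕ) (b : Bool) :
    N.T f (Function.update x p b) = N.T (f * N.density x p b) x := by
  have hpos : ∀ c, 0 ≤ coordMass (N.block p) b c / coordMass (N.block p) (x p) c := fun c =>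
    div_nonneg (coordMass_pos (N.three_le p) _ _).le (coordMass_pos (N.three_le p) _ _).le
  have hmeas : ∀ c, MeasurableSet {y : CantorSpace | y p = c} := fun c =>
    measurableSet_eq_fun (measurable_pi_apply p) measurable_const
  have hint := integrable_cont (N.rho x) f
  have hset : ∀ c, ∫ y in {y | y p = c}, (f * N.density x p b) y ∂(N.rho x) =
      coordMass (N.block p) b c / coordMass (N.block p) (x p) c *
        ∫ y in {y | y p = c}, f y ∂(N.rho x) := fun c => by
    rw [← integral_const_mul]
    refine setIntegral_congr_fun (hmeas c) fun y hy => ?_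
    have hy' : y p = c := hy
    simp only [ContinuousMap.mul_apply, density, ContinuousMap.coe_mk, hy']
    ring
  have hcompl : {y : CantorSpace | y p = false} = {y | y p = true}ᶜ := by
    ext y; simp
  rw [T_apply, T_apply, ← integral_add_compl (hmeas true)
    (integrable_cont (N.rho x) (f * N.density x p b)), ← hcompl, hset, hset, rho_update, integral_add_measure (hint.restrict.smul_measure (by simp))
      (hint.restrict.smul_measure (by simp)), integral_smul_measure, integral_smul_measure,
    ENNReal.toReal_ofReal (hpos _), ENNReal.toReal_ofReal (hpos _)]
  rfl

theorem T_comp_eval (k : Bool → ℝ) (g : C(CantorSpace, ℝ)) (p : ℕ) (hg : ∀ y, g y = k (y p))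
    (x : CantorSpace) : N.T g x = coordMass (N.block p) (x p) true * k true +
      coordMass (N.block p) (x p) false * k false := by
  have h := (measurePreserving_eval_infinitePi (fun i => coordMeasure (N.block i) (x i)) p).map_eq
  have hk : AEStronglyMeasurable k
      ((Measure.infinitePi fun i => coordMeasure (N.block i) (x i)).map (Function.eval p)) :=
    (Measurable.of_discrete (f := k)).aestronglyMeasurable
  have h1 : N.T g x = ∫ c, k c ∂(coordMeasure (N.block p) (x p)) := by
    rw [T_apply, ← h, integral_map (measurable_pi_apply p).aemeasurable hk]
    exact integral_congr_ae (Filter.Eventually.of_forall hg)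
  have hi : ∀ c : Bool, Integrable k (Measure.dirac c) := fun c => integrable_dirac (by simp)
  rw [h1, coordMeasure_eq, integral_add_measure ((hi _).smul_measure (by simp))
    ((hi _).smul_measure (by simp)), integral_smul_measure, integral_smul_measure,
    integral_dirac, integral_dirac, ENNReal.toReal_ofReal (coordMass_pos (N.three_le p) _ _).le,
    ENNReal.toReal_ofReal (coordMass_pos (N.three_le p) _ _).le]
  rfl

/-- The `p`-th factor of `ρ_x` has mean `±((s-1)/s - 1/s)`, with the sign of `f_p x`. -/
theorem T_coordFun (p : ℕ) : N.T (coordFun p) = (1 - 2 / (N.block p : ℝ)) • coordFun p := by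
  have h3 : (3 : ℝ) ≤ N.block p := by exact_mod_cast N.three_le p
  ext x
  rw [N.T_comp_eval (fun c => if c then 1 else -1) (coordFun p) p (fun y => rfl)]
  have : (N.block p : ℝ) ≠ 0 := by positivity
  simp only [coordMass, ContinuousMap.smul_apply, coordFun, ContinuousMap.coe_mk]
  cases x p <;> simp <;> field_simp <;> ring

theorem T_comp_eval_update_of_ne {k : Bool → ℝ} {g : C(CantorSpace, ℝ)} {p q : ℕ}
    (hg : ∀ y, g y = k (y p)) (hpq : p ≠ q) (x : CantorSpace) (b : Bool) :
    N.T g (Function.update x q b) = N.T g x := by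
  rw [N.T_comp_eval k g p hg, N.T_comp_eval k g p hg, Function.update_of_ne hpq]

theorem T_mono {f g : C(CantorSpace, ℝ)} (h : ∀ y, f y ≤ g y) (x : CantorSpace) :
    N.T f x ≤ N.T g x :=
  integral_mono (integrable_cont _ f) (integrable_cont _ g) h

theorem T_one : N.T 1 = 1 := by
  ext x
  simp [T_apply]

theorem T_apply_le_norm (f : C(CantorSpace, ℝ)) (x : CantorSpace) : N.T f x ≤ ‖f‖ := by
  have h := N.T_mono (f := f) (g := ‖f‖ • 1)
    (fun y => by simpa using (le_abs_self _).trans (f.norm_coe_le_norm y)) x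
  simpa [T_one] using h

theorem norm_T_le (f : C(CantorSpace, ℝ)) : ‖N.T f‖ ≤ ‖f‖ :=
  (ContinuousMap.norm_le _ (norm_nonneg _)).2 fun x => by
    rw [Real.norm_eq_abs, abs_le]
    have h := N.T_apply_le_norm (-f) x
    rw [map_neg, norm_neg, ContinuousMap.neg_apply] at h
    exact ⟨by linarith, N.T_apply_le_norm f x⟩

/-- This is the Cauchy–Schwarz inequality against the constant `1`: integrate `2c·fg - c² ≤ (fg)² ≤
‖f‖² g²` with `c` the mean of `fg`. -/
theorem sq_T_mul_le (f g : C(CantorSpace, ℝ)) (x : CantorSpace) :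
    N.T (f * g) x ^ 2 ≤ ‖f‖ ^ 2 * N.T (g * g) x := by
  set c := N.T (f * g) x with hc
  have h := N.T_mono (f := (2 * c) • (f * g) - (c ^ 2) • 1) (g := (‖f‖ ^ 2) • (g * g)) (fun y => by
    have hf : f y ^ 2 ≤ ‖f‖ ^ 2 := by
      rw [sq_le_sq, abs_norm]
      exact f.norm_coe_le_norm y
    have h1 : f y ^ 2 * g y ^ 2 ≤ ‖f‖ ^ 2 * g y ^ 2 := by gcongr
    simp only [ContinuousMap.sub_apply, ContinuousMap.smul_apply, ContinuousMap.mul_apply,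
      ContinuousMap.one_apply, smul_eq_mul]
    nlinarith [sq_nonneg (f y * g y - c)]) x
  simp only [map_sub, map_smul, ContinuousMap.sub_apply, ContinuousMap.smul_apply, T_one,
    ContinuousMap.one_apply, smul_eq_mul, ← hc] at h
  nlinarith

theorem density_mem_Icc (x : CantorSpace) (p : ℕ) (b : Bool) (y : CantorSpace) :
    N.density x p b y ∈ Set.Icc (0 : ℝ) (N.block p) := by
  have h3 : (3 : ℝ) ≤ N.block p := by exact_mod_cast N.three_le p
  refine ⟨div_nonneg (coordMass_pos (N.three_le p) _ _).le (coordMass_pos (N.three_le p) _ _).le, ?_⟩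
  change coordMass (N.block p) b (y p) / coordMass (N.block p) (x p) (y p) ≤ _
  rw [div_le_iff₀ (coordMass_pos (N.three_le p) _ _)]
  have h0 : (0 : ℝ) < N.block p := by linarith
  have h1 : coordMass (N.block p) b (y p) ≤ 1 := by
    unfold coordMass
    split_ifs <;> rw [div_le_one h0] <;> linarith
  have h2 : 1 / (N.block p : ℝ) ≤ coordMass (N.block p) (x p) (y p) := by
    unfold coordMass
    split_ifs
    · gcongr; linarith
    · exact le_rfl
  calc _ ≤ (1 : ℝ) := h1
    _ = N.block p * (1 / N.block p) := by field_simp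
    _ ≤ _ := by gcongr

theorem T_update_sub (f : C(CantorSpace, ℝ)) (x : CantorSpace) (p : ℕ) (b : Bool) :
    N.T f (Function.update x p b) - N.T f x = N.T (f * (N.density x p b - 1)) x := by
  rw [T_update, mul_sub, mul_one, map_sub]
  rfl

/-- Integrating against `density - 1` in coordinate `q` gives the increment of `T` in that
coordinate. It vanishes on functions of another coordinate `p`. -/
theorem T_density_sub_one_mul_of_ne (x : CantorSpace) {p q : ℕ} (hpq : p ≠ q) (b : Bool) :
    N.T ((N.density x p b - 1) * (N.density x q b - 1)) x = 0 := by
  rw [← T_update_sub, sub_eq_zero]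
  exact N.T_comp_eval_update_of_ne (k := fun c => coordMass (N.block p) b c /
    coordMass (N.block p) (x p) c - 1) (fun y => rfl) hpq x b

theorem T_density_sub_one_mul_self_le (x : CantorSpace) (p : ℕ) (b : Bool) :
    N.T ((N.density x p b - 1) * (N.density x p b - 1)) x ≤ (N.block p : ℝ) ^ 2 := by
  have h3 : (3 : ℝ) ≤ N.block p := by exact_mod_cast N.three_le p
  have h := N.T_mono (f := (N.density x p b - 1) * (N.density x p b - 1))
    (g := ((N.block p : ℝ) ^ 2) • 1) (fun y => by
      have := N.density_mem_Icc x p b y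
      simp only [ContinuousMap.sub_apply, ContinuousMap.smul_apply, ContinuousMap.mul_apply,
        ContinuousMap.one_apply, smul_eq_mul]
      nlinarith [this.1, this.2]) x
  simpa [T_one] using h

/-- The random variables `density - 1` are orthogonal, so the increments of `T f` in the
coordinates of one block are small on average. -/
theorem sq_sum_T_update_sub_le {F : Finset ℕ} {s : ℕ} (hF : ∀ p ∈ F, N.block p = s)
    {e : ℕ → ℝ} (he : ∀ p, |e p| ≤ 1) (f : C(CantorSpace, ℝ)) (x : CantorSpace) (b : Bool) :
    (∑ p ∈ F, e p * (N.T f (Function.update x p b) - N.T f x)) ^ 2 ≤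
      ‖f‖ ^ 2 * (F.card * (s : ℝ) ^ 2) := by
  -- The sum of increments is the single integral `T (f * H) x`. Cauchy–Schwarz reduces it to the
  -- mean of `H²`, in which only diagonal terms survive.
  set H : C(CantorSpace, ℝ) := ∑ p ∈ F, e p • (N.density x p b - 1) with hH
  let A : C(CantorSpace, ℝ) →ₗ[ℝ] ℝ :=
    { toFun := fun g => N.T g x
      map_add' := fun g h => by rw [map_add]; rfl
      map_smul' := fun a g => by rw [map_smul]; rfl }
  have h1 : ∑ p ∈ F, e p * (N.T f (Function.update x p b) - N.T f x) = N.T (f * H) x := by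
    change _ = A (f * H)
    rw [hH, Finset.mul_sum, map_sum]
    refine Finset.sum_congr rfl fun p _ => ?_
    rw [mul_smul_comm, map_smul, smul_eq_mul, T_update_sub]
    rfl
  have h2 : N.T (H * H) x ≤ F.card * (s : ℝ) ^ 2 := by
    have : A (H * H) = ∑ p ∈ F, e p ^ 2 *
        A ((N.density x p b - 1) * (N.density x p b - 1)) := by
      rw [hH, Finset.sum_mul_sum, map_sum]
      refine Finset.sum_congr rfl fun p hp => ?_
      rw [map_sum, Finset.sum_eq_single_of_mem p hp]
      · rw [smul_mul_smul_comm, map_smul, smul_eq_mul, sq]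
      · intro q _ hqp
        rw [smul_mul_smul_comm, map_smul]
        change _ • N.T _ x = 0
        rw [N.T_density_sub_one_mul_of_ne x hqp.symm, smul_zero]
    change A (H * H) ≤ _
    rw [this, ← nsmul_eq_mul]
    refine Finset.sum_le_card_nsmul _ _ _ fun p hp => ?_
    have h3 := N.T_density_sub_one_mul_self_le x p b
    rw [hF p hp] at h3
    have h4 : e p ^ 2 ≤ 1 := by
      rw [sq_le_one_iff_abs_le_one]
      exact he p
    calc e p ^ 2 * A ((N.density x p b - 1) * (N.density x p b - 1))
        ≤ e p ^ 2 * (s : ℝ) ^ 2 := by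
          gcongr
          exact h3
      _ ≤ 1 * (s : ℝ) ^ 2 := by gcongr
      _ = _ := one_mul _
  rw [h1]
  exact (N.sq_T_mul_le f H x).trans (by gcongr)

end BlockPartition

/-- The image of a probability measure under the map that sets the coordinate `p` to `b`. -/
noncomputable def updateMeasure (θ : ProbabilityMeasure CantorSpace) (p : ℕ) (b : Bool) :
    ProbabilityMeasure CantorSpace :=
  θ.map (f := fun x => Function.update x p b)
    (continuous_id.update p continuous_const).measurable.aemeasurable

theorem integralFunctional_updateMeasure (θ : ProbabilityMeasure CantorSpace) (p : ℕ) (b : Bool)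
    (f : C(CantorSpace, ℝ)) : integralFunctional (updateMeasure θ p b) f =
      ∫ x, f (Function.update x p b) ∂(θ : Measure CantorSpace) := by
  have h : AEMeasurable (fun x : CantorSpace => Function.update x p b)
      (θ : Measure CantorSpace) := (continuous_id.update p continuous_const).measurable.aemeasurable
  rw [integralFunctional_apply, updateMeasure, ProbabilityMeasure.toMeasure_map,
    integral_map h f.continuous.aestronglyMeasurable]

/-! ### Weak convergence of coordinate changes in Talagrand's set -/

namespace BlockPartition

variable (N : BlockPartition)

/-- The element `T* θ` of Talagrand's set. -/
noncomputable def adjointMeasure (θ : ProbabilityMeasure CantorSpace) :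
    StrongDual ℝ C(CantorSpace, ℝ) :=
  banachAdjoint N.T (integralFunctional θ)

theorem adjointMeasure_mem (θ : ProbabilityMeasure CantorSpace) :
    N.adjointMeasure θ ∈ N.talagrandSet :=
  ⟨_, range_integralFunctional ▸ Set.mem_range_self _, rfl⟩

theorem exists_adjointMeasure_eq {φ : StrongDual ℝ C(CantorSpace, ℝ)} (hφ : φ ∈ N.talagrandSet) :
    ∃ θ, N.adjointMeasure θ = φ := by
  obtain ⟨ψ, hψ, rfl⟩ := hφ
  rw [← range_integralFunctional] at hψ
  obtain ⟨θ, rfl⟩ := hψ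
  exact ⟨θ, rfl⟩

theorem adjointMeasure_update_coordFun (θ : ProbabilityMeasure CantorSpace) (p : ℕ) (b : Bool) :
    N.adjointMeasure (updateMeasure θ p b) (coordFun p) =
      (1 - 2 / (N.block p : ℝ)) * if b then 1 else -1 := by
  change integralFunctional (updateMeasure θ p b) (N.T (coordFun p)) = _
  rw [integralFunctional_updateMeasure, T_coordFun]
  simp [coordFun]

/-- The pointwise estimate on increments is integrated against `θ`. Growth like `√F.card` instead of
`F.card` is what orthogonality gains. -/
theorem norm_sum_adjointMeasure_update_sub_le (θ : ProbabilityMeasure CantorSpace) {F : Finset ℕ}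
    {s : ℕ} (hF : ∀ p ∈ F, N.block p = s) {e : ℕ → ℝ} (he : ∀ p, |e p| ≤ 1) (b : Bool) :
    ‖∑ p ∈ F, e p • (N.adjointMeasure (updateMeasure θ p b) - N.adjointMeasure θ)‖ ≤
      √F.card * s := by
  refine ContinuousLinearMap.opNorm_le_bound _ (by positivity) fun f => ?_
  have hcont : ∀ p, Continuous fun x : CantorSpace => N.T f (Function.update x p b) := fun p =>
    (N.T f).continuous.comp (continuous_id.update p continuous_const)
  have hint : ∀ p, Integrable (fun x : CantorSpace => N.T f (Function.update x p b))
      (θ : Measure CantorSpace) := fun p => integrable_cont _ ⟨_, hcont p⟩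
  have e1 : (∑ p ∈ F, e p • (N.adjointMeasure (updateMeasure θ p b) - N.adjointMeasure θ)) f =
      ∫ x, ∑ p ∈ F, e p * (N.T f (Function.update x p b) - N.T f x)
        ∂(θ : Measure CantorSpace) := by
    have hi : ∀ p ∈ F, Integrable (fun x => e p * (N.T f (Function.update x p b) - N.T f x))
        (θ : Measure CantorSpace) := fun p _ =>
      ((hint p).sub (integrable_cont _ (N.T f))).const_mul _
    rw [integral_finsetSum _ hi, _root_.sum_apply]
    refine Finset.sum_congr rfl fun p _ => ?_
    rw [integral_const_mul, integral_sub (hint p) (integrable_cont _ _),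
      ← integralFunctional_updateMeasure]
    rfl
  rw [e1]
  have hb : ∀ x, ‖∑ p ∈ F, e p * (N.T f (Function.update x p b) - N.T f x)‖ ≤
      √F.card * s * ‖f‖ := fun x => by
    rw [Real.norm_eq_abs]
    refine abs_le_of_sq_le_sq ((N.sq_sum_T_update_sub_le hF he f x b).trans (le_of_eq ?_))
      (mul_nonneg (by positivity) (norm_nonneg f))
    rw [mul_pow, mul_pow, Real.sq_sqrt (Nat.cast_nonneg _)]
    ring
  simpa using norm_integral_le_of_norm_le_const (μ := (θ : Measure CantorSpace))
    (Filter.Eventually.of_forall hb)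

/-- Setting one coordinate of the block `N_s` converges weakly to doing nothing. -/
theorem finite_setOf_le_abs_update_sub (X : Bidual C(CantorSpace, ℝ))
    (θ : ProbabilityMeasure CantorSpace) (s : ℕ) (b : Bool) {δ : ℝ} (hδ : 0 < δ) :
    {p | N.block p = s ∧ δ ≤ |X (N.adjointMeasure (updateMeasure θ p b)) -
      X (N.adjointMeasure θ)|}.Finite := by
  by_contra hinf
  -- With this `n`, the bound `n δ ≤ ‖X‖ s √n` below is impossible.
  obtain ⟨n, hn⟩ := exists_nat_gt ((‖X‖ * s / δ) ^ 2)
  obtain ⟨F, hF, hcard⟩ := Set.Infinite.exists_subset_card_eq hinf n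
  let d : ℕ → ℝ := fun p => X (N.adjointMeasure (updateMeasure θ p b)) - X (N.adjointMeasure θ)
  have h1 : n * δ ≤ ∑ p ∈ F, |d p| := by
    rw [← hcard, ← nsmul_eq_mul]
    exact Finset.card_nsmul_le_sum _ _ _ fun p hp => (hF hp).2
  -- The signs turn the sum of absolute values into `X` of one vector, whose norm is controlled.
  have h2 : ∑ p ∈ F, |d p| = X (∑ p ∈ F, (SignType.sign (d p) : ℝ) •
      (N.adjointMeasure (updateMeasure θ p b) - N.adjointMeasure θ)) := by
    rw [map_sum]
    refine Finset.sum_congr rfl fun p _ => ?_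
    rw [map_smul, map_sub X, smul_eq_mul]
    exact (sign_mul_self (d p)).symm
  have h3 := N.norm_sum_adjointMeasure_update_sub_le θ (fun p hp => (hF hp).1)
    (e := fun p => (SignType.sign (d p) : ℝ)) (fun p => by
      rcases SignType.trichotomy (SignType.sign (d p)) with h | h | h <;> simp [h]) b
  have h4 : n * δ ≤ ‖X‖ * (√n * s) := by
    rw [hcard] at h3
    calc n * δ ≤ _ := h1
      _ = _ := h2
      _ ≤ _ := le_abs_self _
      _ ≤ _ := X.le_opNorm _
      _ ≤ _ := by gcongr
  have hn0 : (0 : ℝ) < n := (sq_nonneg _).trans_lt hn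
  have hsq : 0 < √(n : ℝ) := Real.sqrt_pos.2 hn0
  have h5 : √(n : ℝ) * δ ≤ ‖X‖ * s := by
    have : √(n : ℝ) * (√n * δ) ≤ √n * (‖X‖ * s) := by
      rw [← mul_assoc, Real.mul_self_sqrt hn0.le]
      linarith
    exact le_of_mul_le_mul_left this hsq
  have h6 : √(n : ℝ) ≤ ‖X‖ * s / δ := (le_div_iff₀ hδ).2 h5
  have h7 := pow_le_pow_left₀ hsq.le h6 2
  rw [Real.sq_sqrt hn0.le] at h7
  linarith

end BlockPartition

/-! ### The coordinate functions -/

theorem norm_coordFun_le (p : ℕ) : ‖coordFun p‖ ≤ 1 := by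
  refine (ContinuousMap.norm_le _ zero_le_one).2 fun x => ?_
  simp only [coordFun, ContinuousMap.coe_mk]
  split_ifs <;> simp

theorem norm_sum_smul_coordFun (F : Finset ℕ) (a : ℕ → ℝ) :
    ‖∑ p ∈ F, a p • coordFun p‖ = ∑ p ∈ F, |a p| := by
  apply le_antisymm
  · refine (norm_sum_le _ _).trans (Finset.sum_le_sum fun p _ => ?_)
    rw [norm_smul, Real.norm_eq_abs]
    exact mul_le_of_le_one_right (abs_nonneg _) (norm_coordFun_le p)
  -- At this point every `f_p` takes the sign of `a p`.
  · let x : CantorSpace := fun p => decide (0 ≤ a p)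
    have h : (∑ p ∈ F, a p • coordFun p) x = ∑ p ∈ F, |a p| := by
      rw [ContinuousMap.sum_apply]
      refine Finset.sum_congr rfl fun p _ => ?_
      simp only [ContinuousMap.smul_apply, coordFun, ContinuousMap.coe_mk, smul_eq_mul, x,
        decide_eq_true_eq]
      split_ifs with h0
      · rw [mul_one, abs_of_nonneg h0]
      · rw [mul_neg_one, abs_of_neg (not_le.1 h0)]
    rw [← h]
    exact ContinuousMap.apply_le_norm _ x

namespace BlockPartition

variable (N : BlockPartition)

open TalagrandSpace

theorem norm_S_le (f : C(CantorSpace, ℝ)) : ‖N.S f‖ ≤ ‖f‖ :=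
  (N.norm_S f).le.trans (N.norm_T_le f)

theorem norm_sum_smul_S_coordFun (F : Finset ℕ) (a : ℕ → ℝ) :
    ‖∑ p ∈ F, a p • N.S (coordFun p)‖ = ∑ p ∈ F, |a p| * (1 - 2 / (N.block p : ℝ)) := by
  have e : ∑ p ∈ F, a p • N.S (coordFun p) = N.S (∑ p ∈ F, a p • coordFun p) := by
    rw [map_sum]
    exact Finset.sum_congr rfl fun p _ => (map_smul N.S _ _).symm
  have e2 : N.T (∑ p ∈ F, a p • coordFun p) =
      ∑ p ∈ F, (a p * (1 - 2 / (N.block p : ℝ))) • coordFun p := by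
    rw [map_sum]
    refine Finset.sum_congr rfl fun p _ => ?_
    rw [map_smul, T_coordFun, smul_smul]
  rw [e, norm_S, e2, norm_sum_smul_coordFun]
  refine Finset.sum_congr rfl fun p _ => ?_
  have h3 : (3 : ℝ) ≤ N.block p := by exact_mod_cast N.three_le p
  have : 2 / (N.block p : ℝ) ≤ 1 := by rw [div_le_one (by linarith)]; linarith
  rw [abs_mul, abs_of_nonneg (a := 1 - 2 / (N.block p : ℝ)) (by linarith)]

theorem norm_sum_smul_S_coordFun_le (F : Finset ℕ) (a : ℕ → ℝ) :
    ‖∑ p ∈ F, a p • N.S (coordFun p)‖ ≤ ∑ p ∈ F, |a p| := by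
  rw [norm_sum_smul_S_coordFun]
  refine Finset.sum_le_sum fun p _ => mul_le_of_le_one_right (abs_nonneg _) ?_
  have : 0 ≤ 2 / (N.block p : ℝ) := by positivity
  linarith

theorem le_norm_sum_smul_S_coordFun (F : Finset ℕ) (a : ℕ → ℝ) :
    1 / 3 * ∑ p ∈ F, |a p| ≤ ‖∑ p ∈ F, a p • N.S (coordFun p)‖ := by
  rw [norm_sum_smul_S_coordFun, Finset.mul_sum]
  refine Finset.sum_le_sum fun p _ => ?_
  have h3 : (3 : ℝ) ≤ N.block p := by exact_mod_cast N.three_le p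
  have : 2 / (N.block p : ℝ) ≤ 2 / 3 := by gcongr
  nlinarith [abs_nonneg (a p)]

theorem S_coordFun_ne_zero (p : ℕ) : N.S (coordFun p) ≠ 0 := by
  intro h
  have := N.le_norm_sum_smul_S_coordFun {p} 1
  norm_num [h] at this

/-- The `ℓ₁` estimates give this on finite combinations, and the inequality is a closed condition.
-/
theorem norm_le_of_mem_coordSpan {z : C(CantorSpace, ℝ)} (hz : z ∈ coordSpan) :
    ‖z‖ ≤ 3 * ‖N.S z‖ := by
  have hcl : IsClosed {z : C(CantorSpace, ℝ) | ‖z‖ ≤ 3 * ‖N.S z‖} :=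
    isClosed_le continuous_norm (continuous_const.mul N.S.continuous.norm)
  refine closure_minimal ?_ hcl hz
  intro z hz
  obtain ⟨c, rfl⟩ := Finsupp.mem_span_range_iff_exists_finsupp.1 hz
  have h := N.le_norm_sum_smul_S_coordFun c.support c
  rw [← norm_sum_smul_coordFun] at h
  have e : N.S (c.sum fun p a => a • coordFun p) = ∑ p ∈ c.support, c p • N.S (coordFun p) := by
    rw [Finsupp.sum, map_sum]
    exact Finset.sum_congr rfl fun p _ => map_smul N.S _ _
  change ‖c.sum fun p a => a • coordFun p‖ ≤ 3 * ‖N.S _‖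
  rw [e, Finsupp.sum]
  linarith

/-! ### Octahedrality -/

theorem bidualS_toDualPredual (X : Bidual C(CantorSpace, ℝ)) (y : N.TalagrandSpace) :
    N.bidualS X (N.toDualPredual y) = X (incl N y) := rfl

/-- The functional `X` is linear, so a bound for `|X|` on `𝒞` persists on the hull of `𝒞 ∪ -𝒞`, the
unit ball of `𝒴 = (𝒴_*)*`; no w*-continuity of `X` is needed. The value `b` records the sign. -/
theorem exists_norm_bidualS_lt (X : Bidual C(CantorSpace, ℝ)) {δ : ℝ} (hδ : 0 < δ) :
    ∃ (θ : ProbabilityMeasure CantorSpace) (b : Bool),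
      ‖N.bidualS X‖ - δ ≤ (if b then 1 else -1) * X (N.adjointMeasure θ) := by
  have key : ∃ θ, ‖N.bidualS X‖ - δ ≤ |X (N.adjointMeasure θ)| := by
    by_contra! hcon
    have hC : ∀ φ ∈ N.talagrandSet, |X φ| ≤ ‖N.bidualS X‖ - δ := fun φ hφ => by
      obtain ⟨θ, rfl⟩ := N.exists_adjointMeasure_eq hφ
      exact (hcon θ).le
    have hK : N.talagrandBall ⊆ X ⁻¹' Set.Icc (-(‖N.bidualS X‖ - δ)) (‖N.bidualS X‖ - δ) := by
      refine convexHull_min ?_ ((convex_Icc _ _).linear_preimage X.toLinearMap)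
      rintro φ (h | h)
      · exact abs_le.1 (hC φ h)
      · have := abs_le.1 (hC _ (Set.mem_neg.1 h))
        rw [map_neg] at this
        exact ⟨by linarith [this.2], by linarith [this.1]⟩
    have h0 : 0 ≤ ‖N.bidualS X‖ - δ := by
      obtain ⟨φ, hφ⟩ := N.talagrandSet_nonempty
      exact (abs_nonneg _).trans (hC φ hφ)
    have h1 : ‖N.bidualS X‖ ≤ ‖N.bidualS X‖ - δ := by
      refine ContinuousLinearMap.opNorm_le_of_unit_norm h0 fun ξ hξ => ?_
      obtain ⟨y, hy, rfl⟩ := N.exists_toDualPredual_eq ξ hξ.le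
      rw [bidualS_toDualPredual]
      exact abs_le.2 (hK ((norm_le_one_iff N y).1 hy))
    linarith
  obtain ⟨θ, h⟩ := key
  rcases le_total 0 (X (N.adjointMeasure θ)) with h0 | h0
  · exact ⟨θ, true, by simpa [abs_of_nonneg h0] using h⟩
  · exact ⟨θ, false, by simpa [abs_of_nonpos h0] using h⟩

/-- Every finite subset of the range of `S**` is almost `ℓ₁`-orthogonal to some `f_p`. -/
theorem exists_norm_bidualS_add_coordFun {ι : Type*} [Finite ι] (X : ι → Bidual C(CantorSpace, ℝ))
    {δ : ℝ} (hδ : 0 < δ) : ∃ p, ∀ i, ‖N.bidualS (X i)‖ + 1 - δ ≤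
      ‖N.bidualS (X i) + NormedSpace.inclusionInDoubleDual ℝ N.predual (N.S (coordFun p))‖ := by
  have hδ3 : 0 < δ / 3 := by positivity
  choose θ b hθ using fun i => N.exists_norm_bidualS_lt (X i) hδ3
  -- A block far enough out makes the loss `2/s` at most `δ/3`. The other two thirds of `δ` go to
  -- the choice of `θ` and to the change of coordinate `p`.
  obtain ⟨n, hn⟩ := exists_nat_gt (6 / δ)
  let s := max 3 n
  have hs : 2 / (s : ℝ) ≤ δ / 3 := by
    have h1 : (n : ℝ) ≤ s := by exact_mod_cast le_max_right 3 n
    have h2 : (3 : ℝ) ≤ s := by exact_mod_cast le_max_left 3 n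
    have h3 : 6 < n * δ := (div_lt_iff₀ hδ).1 hn
    rw [div_le_iff₀ (by linarith)]
    nlinarith
  have hfin : (⋃ i, {p | N.block p = s ∧ δ / 3 ≤
      |X i (N.adjointMeasure (updateMeasure (θ i) p (b i))) -
        X i (N.adjointMeasure (θ i))|}).Finite :=
    Set.finite_iUnion fun i => N.finite_setOf_le_abs_update_sub (X i) (θ i) s (b i) hδ3
  -- The block is infinite and only finitely many of its elements are bad for some `i`.
  obtain ⟨p, hp, hpn⟩ := ((N.infinite_block s (le_max_left _ _)).sdiff hfin).nonempty
  have hp' : N.block p = s := hp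
  refine ⟨p, fun i => ?_⟩
  have hX : |X i (N.adjointMeasure (updateMeasure (θ i) p (b i))) -
      X i (N.adjointMeasure (θ i))| < δ / 3 := by
    by_contra! h
    exact hpn (Set.mem_iUnion.2 ⟨i, hp, h⟩)
  set φ := N.adjointMeasure (updateMeasure (θ i) p (b i)) with hφ
  obtain ⟨y, hy, hye⟩ := exists_incl_eq N (φ := φ)
    (subset_convexHull ℝ _ (Or.inl (N.adjointMeasure_mem _)))
  set σ : ℝ := if b i then 1 else -1 with hσ
  have hσ1 : |σ| = 1 := by rw [hσ]; split_ifs <;> simp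
  have hσ2 : σ * σ = 1 := by rw [hσ]; split_ifs <;> simp
  have hf : φ (coordFun p) = (1 - 2 / (s : ℝ)) * σ := by
    rw [hφ, adjointMeasure_update_coordFun, hp']
  have hval : (N.bidualS (X i) + NormedSpace.inclusionInDoubleDual ℝ N.predual
      (N.S (coordFun p))) (N.toDualPredual y) = X i φ + φ (coordFun p) := by
    rw [← hye]; rfl
  have h1 : |X i φ + φ (coordFun p)| ≤ ‖N.bidualS (X i) +
      NormedSpace.inclusionInDoubleDual ℝ N.predual (N.S (coordFun p))‖ := by
    rw [← hval]
    have hle : ∀ W : Bidual N.predual, |W (N.toDualPredual y)| ≤ ‖W‖ := fun W =>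
      (W.le_opNorm _).trans (mul_le_of_le_one_right (norm_nonneg _)
        ((N.norm_toDualPredual_le y).trans hy))
    exact hle _
  have h2 : σ * (X i φ + φ (coordFun p)) ≤ |X i φ + φ (coordFun p)| := by
    refine (le_abs_self _).trans_eq ?_
    rw [abs_mul, hσ1, one_mul]
  have h3 : σ * X i (N.adjointMeasure (θ i)) - σ * X i φ ≤ δ / 3 := by
    rw [← mul_sub]
    refine (le_abs_self _).trans ?_
    rw [abs_mul, hσ1, one_mul, abs_sub_comm]
    exact hX.le
  have h4 : σ * φ (coordFun p) = 1 - 2 / (s : ℝ) := by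
    rw [hf, mul_left_comm, hσ2, mul_one]
  have h5 := hθ i
  rw [mul_add, h4] at h2
  linarith

theorem isOctahedralSetFor_coordFun :
    IsOctahedralSetFor (Set.range fun p => N.S (coordFun p)) N.restrictedBidualBall := by
  constructor
  · rintro _ ⟨p, rfl⟩
    exact ⟨by simpa using (N.norm_S_le _).trans (norm_coordFun_le p), N.S_coordFun_ne_zero p⟩
  · intro n x hx ε hε
    -- One third is lost in the estimate for `S** X`, and two in replacing `x i` by `S** X`, once in
    -- each norm.
    have hδ : 0 < ε / 3 := by positivity
    have happrox : ∀ i, ∃ X, dist (x i) (N.bidualS X) < ε / 3 := fun i => by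
      obtain ⟨_, ⟨X, rfl⟩, h⟩ := Metric.mem_closure_iff.1 (hx i).1 (ε / 3) hδ
      exact ⟨X, h⟩
    choose X hX using happrox
    obtain ⟨p, hp⟩ := N.exists_norm_bidualS_add_coordFun X hδ
    refine ⟨_, ⟨p, rfl⟩, fun i => ?_⟩
    set y := NormedSpace.inclusionInDoubleDual ℝ N.predual (N.S (coordFun p))
    have h1 := hX i
    rw [dist_eq_norm] at h1
    have h2 : ‖x i‖ ≤ ‖N.bidualS (X i)‖ + ε / 3 := by
      have := norm_le_norm_add_norm_sub' (x i) (N.bidualS (X i))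
      linarith
    have h3 : ‖N.bidualS (X i) + y‖ ≤ ‖x i + y‖ + ε / 3 := by
      have := norm_le_norm_add_norm_sub (x i + y) (N.bidualS (X i) + y)
      rw [add_sub_add_right_eq_sub] at this
      linarith
    have h4 := hp i
    nlinarith [norm_nonneg (x i)]

end BlockPartition

/-! ### Octahedral biduals of `ℓ₁`-sums -/

/-- It is enough to test octahedrality on finite sets. -/
theorem isOctahedral_of_forall_finite {X : Type*} [NormedAddCommGroup X] [NormedSpace ℝ X]
    (h : ∀ s : Set X, s.Finite → ∀ δ : ℝ, 0 < δ →
      ∃ y : X, ‖y‖ ≤ 1 ∧ ∀ x ∈ s, ‖x‖ + 1 - δ ≤ ‖x + y‖) : IsOctahedral X := by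
  intro E hE ε hε
  -- Four errors of size `δ` add up: the one in the hypothesis, two from the net and one from
  -- normalising `y₀`.
  set δ := min ε 1 / 4 with hδ
  have hδ0 : 0 < δ := by positivity
  have hδε : 4 * δ ≤ ε := by rw [hδ]; linarith [min_le_left ε 1]
  have hδ1 : 4 * δ ≤ 1 := by rw [hδ]; linarith [min_le_right ε 1]
  have : ProperSpace E := FiniteDimensional.proper ℝ E
  obtain ⟨t, -, htfin, htcov⟩ := (isCompact_closedBall (0 : E) 1).finite_cover_balls hδ0
  -- Including `0` in the finite set forces `‖y₀‖ ≥ 1 - δ`.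
  obtain ⟨y₀, hy1, hy⟩ := h (insert 0 (Subtype.val '' t)) ((htfin.image _).insert 0) δ hδ0
  have hr : 1 - δ ≤ ‖y₀‖ := by simpa using hy 0 (Set.mem_insert _ _)
  have hr0 : 0 < ‖y₀‖ := by linarith
  set y : X := ‖y₀‖⁻¹ • y₀ with hydef
  have hy0 : y₀ = ‖y₀‖ • y := by rw [hydef, smul_inv_smul₀ hr0.ne']
  have hynorm : ‖y‖ = 1 := by rw [hydef, norm_smul, norm_inv, norm_norm, inv_mul_cancel₀ hr0.ne']
  have hdist : ‖y₀ - y‖ ≤ δ := by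
    have : y₀ - y = (‖y₀‖ - 1) • y := by rw [sub_smul, one_smul, ← hy0]
    rw [this, norm_smul, hynorm, mul_one, Real.norm_eq_abs, abs_le]
    exact ⟨by linarith, by linarith⟩
  have hball : ∀ x ∈ E, ‖x‖ ≤ 1 → ‖x‖ + 1 - 4 * δ ≤ ‖x + y‖ := by
    intro x hx hx1
    have hx' : (⟨x, hx⟩ : E) ∈ Metric.closedBall (0 : E) 1 := by simpa using hx1
    obtain ⟨z, hz, hzx⟩ := Set.mem_iUnion₂.1 (htcov hx')
    have hzx' : ‖x - z‖ < δ := by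
      rw [Metric.mem_ball, dist_eq_norm] at hzx
      exact hzx
    have h1 := hy z (Set.mem_insert_of_mem _ ⟨z, hz, rfl⟩)
    have h2 : ‖x‖ ≤ ‖(z : X)‖ + ‖x - z‖ := norm_le_norm_add_norm_sub' _ _
    have h3 : ‖(z : X) + y₀‖ ≤ ‖x + y‖ + ‖x - z‖ + ‖y₀ - y‖ := by
      have e : (z : X) + y₀ = (x + y) - (x - z) + (y₀ - y) := by abel
      rw [e]
      exact (norm_add_le _ _).trans (add_le_add_left (norm_sub_le _ _) _)
    linarith
  refine ⟨y, hynorm, fun x hx => ?_⟩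
  rw [hynorm]
  rcases le_or_gt ‖x‖ 1 with hx1 | hx1
  · have := hball x hx hx1
    nlinarith [norm_nonneg x]
  · have hx0 : 0 < ‖x‖ := by linarith
    have hu : ‖‖x‖⁻¹ • x‖ = 1 := by rw [norm_smul, norm_inv, norm_norm, inv_mul_cancel₀ hx0.ne']
    have h1 := hball (‖x‖⁻¹ • x) (E.smul_mem _ hx) hu.le
    rw [hu] at h1
    -- Scaling the estimate at `x/‖x‖` by `‖x‖` puts the coefficient `‖x‖` on `y`; the excess `‖x‖ -
    -- 1` is removed by the triangle inequality.
    have h2 : ‖x‖ * ‖‖x‖⁻¹ • x + y‖ ≤ ‖x + y‖ + (‖x‖ - 1) := by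
      have e : ‖x‖ • (‖x‖⁻¹ • x + y) = (x + y) + (‖x‖ - 1) • y := by
        rw [smul_add, smul_inv_smul₀ hx0.ne', sub_smul, one_smul]
        abel
      calc ‖x‖ * ‖‖x‖⁻¹ • x + y‖ = ‖(x + y) + (‖x‖ - 1) • y‖ := by
            rw [← e, norm_smul, norm_norm]
        _ ≤ _ := norm_add_le _ _
        _ = _ := by rw [norm_smul, hynorm, mul_one, Real.norm_of_nonneg (by linarith)]
    have h3 := mul_le_mul_of_nonneg_left h1 hx0.le
    nlinarith

theorem ContinuousLinearMap.exists_norm_sub_le_apply {D : Type*} [SeminormedAddCommGroup D]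
    [NormedSpace ℝ D] (w : StrongDual ℝ D) {δ : ℝ} (hδ : 0 < δ) :
    ∃ ξ : D, ‖ξ‖ ≤ 1 ∧ ‖w‖ - δ ≤ w ξ := by
  by_contra! hcon
  have h0 : 0 ≤ ‖w‖ - δ := by
    have := hcon 0 (by simp)
    rw [map_zero] at this
    exact this.le
  have := w.opNorm_le_of_unit_norm h0 fun ξ hξ => by
    have h1 := hcon ξ hξ.le
    have h2 := hcon (-ξ) (by rw [norm_neg]; exact hξ.le)
    rw [map_neg] at h2
    exact abs_le.2 ⟨by linarith, by linarith⟩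
  linarith

section BidualSum

variable {X A B : Type*} [SeminormedAddCommGroup X] [NormedSpace ℝ X] [SeminormedAddCommGroup A]
  [NormedSpace ℝ A] [SeminormedAddCommGroup B] [NormedSpace ℝ B]

/-- A functional on a space with norm `‖S x‖ + ‖Q x‖` comes from functionals on the two
summands. -/
theorem exists_dual_decomposition (S : X →L[ℝ] A) (Q : X →L[ℝ] B)
    (h : ∀ x, ‖x‖ = ‖S x‖ + ‖Q x‖) (φ : StrongDual ℝ X) :
    ∃ (ξ : StrongDual ℝ A) (η : StrongDual ℝ B), ‖ξ‖ ≤ ‖φ‖ ∧ ‖η‖ ≤ ‖φ‖ ∧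
      φ = ξ.comp S + η.comp Q := by
  -- The map `J` preserves norms into the `ℓ₁`-sum. Thus `φ` is carried to its range, extended by
  -- Hahn–Banach and restricted to the two summands.
  let J : X →ₗ[ℝ] WithLp 1 (A × B) :=
    (WithLp.linearEquiv 1 ℝ (A × B)).symm.toLinearMap ∘ₗ (S.toLinearMap.prod Q.toLinearMap)
  have hJ : ∀ x, ‖J x‖ = ‖x‖ := fun x => by
    rw [WithLp.prod_norm_eq_of_L1, h]
    rfl
  -- The space is only seminormed, so `J` may have a kernel; `φ` vanishes on it because its elements
  -- have norm zero.
  have hker : LinearMap.ker J ≤ LinearMap.ker φ.toLinearMap := fun x hx => by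
    rw [LinearMap.mem_ker] at hx ⊢
    have h0 : ‖x‖ = 0 := by rw [← hJ, hx, norm_zero]
    have h1 := φ.le_opNorm x
    rw [h0, mul_zero] at h1
    exact norm_le_zero_iff.1 h1
  obtain ⟨G, hG⟩ : ∃ G : LinearMap.range J →ₗ[ℝ] ℝ, ∀ x, G ⟨J x, x, rfl⟩ = φ x := by
    refine ⟨(LinearMap.ker J).liftQ φ.toLinearMap hker ∘ₗ J.quotKerEquivRange.symm.toLinearMap,
      fun x => ?_⟩
    have : J.quotKerEquivRange.symm ⟨J x, x, rfl⟩ = (LinearMap.ker J).mkQ x :=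
      LinearMap.quotKerEquivRange_symm_apply_image J x _
    simp [this]
  let G' : StrongDual ℝ (LinearMap.range J) := G.mkContinuous ‖φ‖ (by
    rintro ⟨_, x, rfl⟩
    rw [hG]
    exact (φ.le_opNorm x).trans_eq (by rw [← hJ x]; rfl))
  obtain ⟨F, hF, hFn⟩ := exists_extension_norm_eq (LinearMap.range J) G'
  have hFφ : ‖F‖ ≤ ‖φ‖ := hFn.trans_le (LinearMap.mkContinuous_norm_le _ (norm_nonneg _) _)
  have hFJ : ∀ x, F (J x) = φ x := fun x => (hF ⟨J x, x, rfl⟩).trans (hG x)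
  let ξ : StrongDual ℝ A := LinearMap.mkContinuous
    (F.toLinearMap ∘ₗ (WithLp.linearEquiv 1 ℝ (A × B)).symm.toLinearMap ∘ₗ
      LinearMap.inl ℝ A B) ‖φ‖ (fun a => by
        refine (F.le_opNorm _).trans ?_
        gcongr
        rw [WithLp.prod_norm_eq_of_L1]
        simp)
  let η : StrongDual ℝ B := LinearMap.mkContinuous
    (F.toLinearMap ∘ₗ (WithLp.linearEquiv 1 ℝ (A × B)).symm.toLinearMap ∘ₗ
      LinearMap.inr ℝ A B) ‖φ‖ (fun b => by
        refine (F.le_opNorm _).trans ?_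
        gcongr
        rw [WithLp.prod_norm_eq_of_L1]
        simp)
  refine ⟨ξ, η, LinearMap.mkContinuous_norm_le _ (norm_nonneg _) _,
    LinearMap.mkContinuous_norm_le _ (norm_nonneg _) _, ?_⟩
  ext x
  have e : J x = (WithLp.linearEquiv 1 ℝ (A × B)).symm (LinearMap.inl ℝ A B (S x)) +
      (WithLp.linearEquiv 1 ℝ (A × B)).symm (LinearMap.inr ℝ A B (Q x)) := by
    rw [← map_add]
    simp [J]
  rw [← hFJ, e, map_add]
  rfl

/-- The unit ball of `X*` is the set of all `ξ ∘ S + η ∘ Q` with `‖ξ‖, ‖η‖ ≤ 1`, and `ξ` and `η` can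
be chosen independently to norm the two components. -/
theorem norm_eq_add_of_norm_eq_add (S : X →L[ℝ] A) (Q : X →L[ℝ] B)
    (h : ∀ x, ‖x‖ = ‖S x‖ + ‖Q x‖) (x : StrongDual ℝ (StrongDual ℝ X)) :
    ‖x‖ = ‖x.comp (ContinuousLinearMap.precomp ℝ S)‖ +
      ‖x.comp (ContinuousLinearMap.precomp ℝ Q)‖ := by
  set xS := x.comp (ContinuousLinearMap.precomp ℝ S)
  set xQ := x.comp (ContinuousLinearMap.precomp ℝ Q)
  apply le_antisymm
  · refine x.opNorm_le_bound (by positivity) fun φ => ?_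
    obtain ⟨ξ, η, hξ, hη, rfl⟩ := exists_dual_decomposition S Q h φ
    rw [map_add]
    calc ‖x (ξ.comp S) + x (η.comp Q)‖ ≤ ‖xS ξ‖ + ‖xQ η‖ := norm_add_le _ _
      _ ≤ ‖xS‖ * ‖ξ‖ + ‖xQ‖ * ‖η‖ := add_le_add (xS.le_opNorm _) (xQ.le_opNorm _)
      _ ≤ ‖xS‖ * ‖ξ.comp S + η.comp Q‖ + ‖xQ‖ * ‖ξ.comp S + η.comp Q‖ := by gcongr
      _ = _ := by ring
  · refine le_of_forall_pos_le_add fun δ hδ => ?_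
    obtain ⟨ξ, hξ, h1⟩ := xS.exists_norm_sub_le_apply (half_pos hδ)
    obtain ⟨η, hη, h2⟩ := xQ.exists_norm_sub_le_apply (half_pos hδ)
    have hn : ‖ξ.comp S + η.comp Q‖ ≤ 1 := by
      refine ContinuousLinearMap.opNorm_le_bound _ zero_le_one fun v => ?_
      rw [one_mul, h v]
      refine (norm_add_le _ _).trans (add_le_add ?_ ?_)
      · exact (ξ.le_opNorm _).trans (mul_le_of_le_one_left (norm_nonneg _) hξ)
      · exact (η.le_opNorm _).trans (mul_le_of_le_one_left (norm_nonneg _) hη)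
    have h3 : xS ξ + xQ η ≤ ‖x‖ := by
      have e : xS ξ + xQ η = x (ξ.comp S + η.comp Q) := by rw [map_add]; rfl
      rw [e]
      exact (le_abs_self _).trans ((x.le_opNorm _).trans
        (mul_le_of_le_one_right (norm_nonneg _) hn))
    linarith

end BidualSum

/-! ### The renorming -/

namespace Renormed

variable {X : Type*} [NormedAddCommGroup X] [NormedSpace ℝ X] (q : Seminorm ℝ X)
  (hq : IsEquivNorm q)

/-- The identity of `X`, as a linear map onto the renormed space. -/
def of : X →ₗ[ℝ] Renormed q hq := LinearMap.id (M := X)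

/-- A linear map that is bounded for the norm `q`, on the renormed space. -/
noncomputable def lift {Y : Type*} [SeminormedAddCommGroup Y] [NormedSpace ℝ Y] (L : X →ₗ[ℝ] Y)
    (C : ℝ) (hL : ∀ x, ‖L x‖ ≤ C * q x) : Renormed q hq →L[ℝ] Y :=
  LinearMap.mkContinuous (show Renormed q hq →ₗ[ℝ] Y from L) C hL

/-- The quotient map onto the quotient of the renormed space by a subspace. -/
noncomputable def quotientMap (Z : Submodule ℝ X) :
    X →ₗ[ℝ] Renormed q hq ⧸ Z.map (of q hq) :=
  (Z.map (of q hq)).mkQ ∘ₗ of q hq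

theorem norm_quotientMap (Z : Submodule ℝ X) (x : X) :
    ‖quotientMap q hq Z x‖ = ⨅ z : Z, q (x - z) := by
  change ‖((of q hq x : Renormed q hq) : Renormed q hq ⧸ (Z.map (of q hq)).toAddSubgroup)‖ = _
  rw [QuotientAddGroup.norm_mk, Metric.infDist_eq_iInf]
  have e : Function.Surjective fun z : Z =>
      (⟨of q hq z, z, z.2, rfl⟩ : (Z.map (of q hq)).toAddSubgroup) := by
    rintro ⟨_, z, hz, rfl⟩
    exact ⟨⟨z, hz⟩, rfl⟩
  refine (e.iInf_comp (fun w : (Z.map (of q hq)).toAddSubgroup =>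
    dist (of q hq x) (w : Renormed q hq))).symm.trans ?_
  refine iInf_congr fun z => ?_
  rw [dist_eq_norm]
  rfl

theorem norm_quotientMap_eq_zero {Z : Submodule ℝ X} {x : X} (hx : x ∈ Z) :
    quotientMap q hq Z x = 0 :=
  (Submodule.Quotient.mk_eq_zero _).2 ⟨x, hx, rfl⟩

end Renormed

theorem coordFun_mem_coordSpan (p : ℕ) : coordFun p ∈ coordSpan :=
  Submodule.le_topologicalClosure _ (Submodule.subset_span ⟨p, rfl⟩)

namespace BlockPartition

variable (N : BlockPartition) (q : Seminorm ℝ C(CantorSpace, ℝ)) (hq : IsEquivNorm q)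

/-- The seminorm `f ↦ |f|_𝒴|_* + dist_q(f, Z)`. -/
noncomputable def octahedralNorm : Seminorm ℝ C(CantorSpace, ℝ) :=
  (normSeminorm ℝ N.predual).comp N.S.toLinearMap +
    (normSeminorm ℝ _).comp (Renormed.quotientMap q hq coordSpan)

theorem octahedralNorm_eq_add (f : C(CantorSpace, ℝ)) :
    N.octahedralNorm q hq f = ‖N.S f‖ + ‖Renormed.quotientMap q hq coordSpan f‖ := rfl

theorem octahedralNorm_apply (f : C(CantorSpace, ℝ)) :
    N.octahedralNorm q hq f = ‖N.S f‖ + ⨅ z : coordSpan, q (f - z) := by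
  rw [octahedralNorm_eq_add, Renormed.norm_quotientMap]

/-- For `z ∈ Z` one has `‖f‖ ≤ 3‖S z‖ + ‖f - z‖ ≤ 3‖S f‖ + 4‖f - z‖`, and `c‖f - z‖ ≤ q (f - z)`.
This gives the constant `3 + 4/c`. -/
theorem exists_norm_le_octahedralNorm :
    ∃ K : ℝ, 0 < K ∧ ∀ f, ‖f‖ ≤ K * N.octahedralNorm q hq f := by
  obtain ⟨c, C, hc, h⟩ := id hq
  refine ⟨3 + 4 / c, by positivity, fun f => ?_⟩
  have h1 : c / 4 * (‖f‖ - 3 * ‖N.S f‖) ≤ ⨅ z : coordSpan, q (f - z) := by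
    refine le_ciInf fun z => ?_
    have h2 := N.norm_le_of_mem_coordSpan z.2
    have h3 : ‖f‖ ≤ ‖(z : C(CantorSpace, ℝ))‖ + ‖f - z‖ := norm_le_norm_add_norm_sub' _ _
    have h4 : ‖N.S z‖ ≤ ‖N.S f‖ + ‖f - z‖ := by
      have := norm_le_norm_add_norm_sub (N.S f) (N.S z)
      rw [← map_sub] at this
      linarith [N.norm_S_le (f - z)]
    have h5 := (h (f - z)).1
    have h6 : ‖f‖ - 3 * ‖N.S f‖ ≤ 4 * ‖f - z‖ := by linarith
    calc c / 4 * (‖f‖ - 3 * ‖N.S f‖) ≤ c / 4 * (4 * ‖f - z‖) := by gcongr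
      _ = c * ‖f - z‖ := by ring
      _ ≤ _ := h5
  rw [octahedralNorm_apply]
  set I := ⨅ z : coordSpan, q (f - z)
  have h0 : 0 ≤ I := Real.iInf_nonneg fun z => apply_nonneg q _
  have h7 : ‖f‖ - 3 * ‖N.S f‖ ≤ 4 / c * I := by
    have : 4 / c * (c / 4 * (‖f‖ - 3 * ‖N.S f‖)) ≤ 4 / c * I := by gcongr
    have e : 4 / c * (c / 4 * (‖f‖ - 3 * ‖N.S f‖)) = ‖f‖ - 3 * ‖N.S f‖ := by field_simp
    rwa [e] at this
  have h8 : 0 ≤ 4 / c * ‖N.S f‖ := by positivity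
  linarith

theorem isEquivNorm_octahedralNorm : IsEquivNorm (N.octahedralNorm q hq) := by
  obtain ⟨K, hK, hle⟩ := N.exists_norm_le_octahedralNorm q hq
  obtain ⟨c, C, hc, h⟩ := id hq
  refine ⟨K⁻¹, 1 + C, inv_pos.2 hK, fun f => ⟨(inv_mul_le_iff₀ hK).2 (hle f), ?_⟩⟩
  rw [octahedralNorm_apply]
  have h1 : ⨅ z : coordSpan, q (f - z) ≤ q f := by
    have : q (f - ((0 : coordSpan) : C(CantorSpace, ℝ))) = q f := by simp
    rw [← this]
    exact ciInf_le ⟨0, by rintro _ ⟨z, rfl⟩; exact apply_nonneg q _⟩ (0 : coordSpan)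
  linarith [(h f).2, N.norm_S_le f]

/-- The bidual norm is the sum of the norms of the images under `S**` and under the bidual of the
quotient map. The witness `f_p` has zero second component, so the first one decides. -/
theorem isOctahedral_bidual_octahedralNorm (hp : IsEquivNorm (N.octahedralNorm q hq)) :
    IsOctahedral (Bidual (Renormed (N.octahedralNorm q hq) hp)) := by
  set r := N.octahedralNorm q hq with hr
  obtain ⟨K, hK, hle⟩ := N.exists_norm_le_octahedralNorm q hq
  let I : Renormed r hp →L[ℝ] C(CantorSpace, ℝ) := Renormed.lift r hp LinearMap.id K hle
  let Q := Renormed.lift r hp (Renormed.quotientMap q hq coordSpan) 1 fun f => by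
    rw [one_mul, hr, octahedralNorm_eq_add]
    linarith [norm_nonneg (N.S f)]
  have hadd : ∀ x, ‖x‖ = ‖(N.S.comp I) x‖ + ‖Q x‖ := fun x => rfl
  refine isOctahedral_of_forall_finite fun s hs δ hδ => ?_
  have : Finite s := hs
  -- The given functionals are moved into `C(Δ)**` by the second adjoint of the identity `I`, where
  -- the estimate for `S**` applies.
  obtain ⟨p, hoct⟩ := N.exists_norm_bidualS_add_coordFun
    (fun x : s => (x : Bidual (Renormed r hp)).comp (ContinuousLinearMap.precomp ℝ I)) hδ
  set u : Renormed r hp := Renormed.of r hp (coordFun p) with hu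
  have hQu : Q u = 0 := Renormed.norm_quotientMap_eq_zero q hq (coordFun_mem_coordSpan p)
  refine ⟨NormedSpace.inclusionInDoubleDual ℝ _ u, ?_, fun x hx => ?_⟩
  · refine (NormedSpace.double_dual_bound ℝ _ u).trans ?_
    rw [hadd, hQu, norm_zero, add_zero]
    exact (N.norm_S_le _).trans (norm_coordFun_le p)
  · have h1 := hoct ⟨x, hx⟩
    rw [norm_eq_add_of_norm_eq_add (N.S.comp I) Q hadd x,
      norm_eq_add_of_norm_eq_add (N.S.comp I) Q hadd]
    have e : (x + NormedSpace.inclusionInDoubleDual ℝ _ u).comp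
        (ContinuousLinearMap.precomp ℝ Q) = x.comp (ContinuousLinearMap.precomp ℝ Q) := by
      ext η
      change x (η.comp Q) + η (Q u) = x (η.comp Q)
      rw [hQu, map_zero, add_zero]
    rw [e]
    have h2 : ‖x.comp (ContinuousLinearMap.precomp ℝ (N.S.comp I))‖ + 1 - δ ≤
        ‖(x + NormedSpace.inclusionInDoubleDual ℝ _ u).comp
          (ContinuousLinearMap.precomp ℝ (N.S.comp I))‖ := h1
    linarith

/-- A partition of `ℕ` into infinitely many infinite sets. -/
def ofUnpair : BlockPartition where
  block i := 3 + (Nat.unpair i).1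
  three_le i := Nat.le_add_right 3 _
  infinite_block s hs := by
    refine Set.infinite_of_injective_forall_mem (f := fun n => Nat.pair (s - 3) n)
      (fun m n h => (Nat.pair_eq_pair.1 h).2) fun n => ?_
    simp only [Set.mem_ofPred_eq, Nat.unpair_pair]
    omega

end BlockPartition

theorem isEquivNorm_normSeminorm (X : Type*) [NormedAddCommGroup X] [NormedSpace ℝ X] :
    IsEquivNorm (normSeminorm ℝ X) :=
  ⟨1, 1, one_pos, fun x => by simp⟩

theorem theorem4p1 :
    -- `C(Δ)` has an equivalent norm whose bidual norm is octahedral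
    (∃ (p : Seminorm ℝ C(CantorSpace, ℝ)) (hp : IsEquivNorm p),
      IsOctahedral (Bidual (Renormed p hp))) ∧
    -- and such norms are built from Talagrand's set of any partition as follows
    ∀ N : BlockPartition,
      -- `𝒞` is convex and w*-compact
      Convex ℝ N.talagrandSet ∧
      IsCompact (WeakDual.toStrongDual ⁻¹' N.talagrandSet :
        Set (WeakDual ℝ C(CantorSpace, ℝ))) ∧
      -- the closed unit ball of `(𝒴, |·|)` is `co(𝒞 ∪ -𝒞)`, and `𝒴_*` is a predual of `(𝒴, |·|)`
      BlockPartition.TalagrandSpace.incl N '' Metric.closedBall 0 1 = N.talagrandBall ∧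
      (∀ y : N.TalagrandSpace, ‖N.toDualPredual y‖ = ‖y‖) ∧
      Function.Surjective N.toDualPredual ∧
      -- `(f_p)` is an isometric `ℓ₁`-sequence in `C(Δ)` and `(f_p|_𝒴)` is an isomorphic
      -- `ℓ₁`-sequence in `𝒴_*`
      (∀ (F : Finset ℕ) (a : ℕ → ℝ),
        ‖∑ p ∈ F, a p • coordFun p‖ = ∑ p ∈ F, |a p| ∧
        ‖∑ p ∈ F, a p • N.S (coordFun p)‖ ≤ ∑ p ∈ F, |a p| ∧
        1 / 3 * ∑ p ∈ F, |a p| ≤ ‖∑ p ∈ F, a p • N.S (coordFun p)‖) ∧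
      -- `{f_p|_𝒴}` is an octahedral set
      IsOctahedralSetFor (Set.range fun p => N.S (coordFun p)) N.restrictedBidualBall ∧
      -- for every equivalent norm `q`, the norm `|f|_𝒴|_* + dist_q(f, Z)` on `C(Δ)` is equivalent
      -- and its bidual norm is octahedral
      ∀ q : Seminorm ℝ C(CantorSpace, ℝ), IsEquivNorm q →
        ∃ (p : Seminorm ℝ C(CantorSpace, ℝ)) (hp : IsEquivNorm p),
          (∀ f, p f = ‖N.S f‖ + ⨅ z : coordSpan, q (f - z)) ∧
          IsOctahedral (Bidual (Renormed p hp)) := by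
  refine ⟨⟨_, BlockPartition.isEquivNorm_octahedralNorm .ofUnpair _
    (isEquivNorm_normSeminorm C(CantorSpace, ℝ)),
    BlockPartition.isOctahedral_bidual_octahedralNorm _ _ _ _⟩, fun N => ?_⟩
  refine ⟨N.convex_talagrandSet, N.isCompact_talagrandSet,
    BlockPartition.TalagrandSpace.incl_image_closedBall N, N.norm_toDualPredual,
    N.toDualPredual_surjective, fun F a => ⟨norm_sum_smul_coordFun F a,
      N.norm_sum_smul_S_coordFun_le F a, N.le_norm_sum_smul_S_coordFun F a⟩,
    N.isOctahedralSetFor_coordFun, fun q hq => ?_⟩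
  exact ⟨N.octahedralNorm q hq, N.isEquivNorm_octahedralNorm q hq, N.octahedralNorm_apply q hq,
    N.isOctahedral_bidual_octahedralNorm q hq _⟩
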